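/- Let $a_0,\dots,a_5\in\mathbb C$. Consider the tangential pencil of plane conics $C(s)=C(0)+sC$, $s\in\mathbb{CP}^1$, where in line coordinates $C(0)$ is $a_0w_1^2+a_2w_2^2+a_4w_3^2+2a_3w_2w_3+2a_5w_1w_3+2a_1w_1w_2=0$ and $C=C(\infty)$ is $w_2^2-4w_1w_3=0$. Assume general position: the conics of the pencil have exactly four distinct common tangents. The tangents to $C$ are the lines $z_1x^2-2z_2x+z_3=0$, $x\in\mathbb{CP}^1$; the tangents with parameters $x_1,x_2$ meet at the point $(1,\frac{x_1+x_2}2,x_1x_2)$ (the point of contact if $x_1=x_2$), and this point lies on $C(s)$ iff $F(s,x_1,x_2)=L(x_1,x_2)s^2+K(x_1,x_2)s+H(x_1,x_2)=0$, where $F$ is the determinant of the matrix of $C(s)$ bordered by the coordinates of the point. One has $K^2-4LH=P(x_1)P(x_2)$ with $P(x)=a_0x^4-4a_1x^3+(2a_5+4a_2)x^2-4a_3x+a_4$. Let $\Gamma_1$ be the complete curve $y^2=P(x)$, and let $\Gamma_2$ be the cubic $t^2=J(s)$, where $J(s)$ is the determinant of the matrix of $C(s)$, with its group law with zero at $s=\infty$.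 The two-valued coset group $(\Gamma_2,\mathbb Z_2)$ is the set $\Gamma_2/\{\pm1\}\cong\mathbb{CP}^1$ (with coordinate $s$, so that its element $P$ determines a conic $C_P$ of the pencil) with the operation $[g]*[h]=[\,[g+h],[g-h]\,]$. It acts on $\Gamma_1$ through the pencil: the values of $P\circ M$ for $M=(x_1,y_1)$ are the points $N=(x_2,y_2)\in\Gamma_1$ such that the tangents with parameters $x_1$ and $x_2$ meet on $C_P$, i.e. $F(s,x_1,x_2)=0$, and $\partial F/\partial s=y_1y_2$ (for $s=\infty$: $-K=y_1y_2$), where $s$ is the coordinate of $P$. Associativity of $*$ means that the multisets $P*(Q*R)$ and $(P*Q)*R$ are equal for all $P,Q,R$; associativity of the action means that the multisets $Q\circ(P\circ M)$ and $(Q*P)\circ M$ are equal for all $P,Q$ and all $M\in\Gamma_1$. Great Poncelet Theorem for triangles (for the pencil and $C$). Call $(a_1,a_2,a_3)$ a Poncelet triangle for nondegenerate conics $C_1,C_2,C_3$ of the pencil if $a_1,a_2,a_3$ are distinct tangents to $C$ such that $a_1\cap a_2\in C_1$, $a_2\cap a_3\in C_2$, $a_1\cap a_3\in C_3$, and the tangents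 to $C_1,C_2,C_3$ at these three points are not concurrent. If $C_1,C_2,C_3$ have one Poncelet triangle, then for all tangents $b_1,b_2$ to $C$ which meet on $C_1$ there is a tangent $b_3$ to $C$ such that $b_2\cap b_3\in C_2$, $b_1\cap b_3\in C_3$, and $(b_1,b_2,b_3)$ is again a Poncelet triangle whenever $b_1,b_2,b_3$ are distinct and none of them is a common tangent of the pencil. Theorem. Under these assumptions: 1. For all $P\in\Gamma_2/\{\pm1\}$ and $M\in\Gamma_1$ the set of values of $P\circ M$ is $\{N_1,N_2\}$ for some $N_1,N_2\in\Gamma_1$ (possibly equal), so that the two-valued map $P\circ M=[N_1,N_2]$ is defined. 2. The operation of the two-valued coset group $(\Gamma_2,\mathbb Z_2)$ and its action on $\Gamma_1$ are both associative if and only if the Great Poncelet Theorem for triangles holds for the pencil. 3. The equivalence holds conic by conic: for all $P,Q,R\in\Gamma_2/\{\pm1\}$ the following are equivalent: (a) $R$ is one of the two values of $Q*P$; (b) there is $R'$, independent of $M$, such that $Q\circ(P\circ M)$ is the union of the multisets $R\circ M$ and $R'\circ M$ for all $M\in\Gamma_1$; (c) for all tangents $b_1,b_2$ to $C$ with $b_1\cap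 b_2\in C_P$ there is a tangent $b_3$ to $C$ with $b_2\cap b_3\in C_Q$ and $b_1\cap b_3\in C_R$. -/

import Mathlib

/-! ## Multivalued groups and their actions -/

namespace MultiValued

/-- Associativity of an `n`-valued operation `x * y = [z₁, …, zₙ]`: the two `n²`-multisets
`x * (y * z)` and `(x * y) * z` agree for all `x, y, z`. -/
def Associative {X : Type*} {n : ℕ} (m : X → X → Sym X n) : Prop :=
  ∀ x y z : X,
    ((m y z : Multiset X).bind fun u => (m x u : Multiset X)) =
      (m x y : Multiset X).bind fun u => (m u z : Multiset X)

/-- Associativity of an `n`-valued action `φ` of `(X, m)` on `Y`: the two `n²`-multisets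
`x₁ ∘ (x₂ ∘ y)` and `(x₁ * x₂) ∘ y` agree for all `x₁, x₂, y`. -/
def ActionAssociative {X Y : Type*} {n : ℕ} (m : X → X → Sym X n) (φ : X → Y → Sym Y n) : Prop :=
  ∀ (x₁ x₂ : X) (y : Y),
    ((φ x₂ y : Multiset Y).bind fun u => (φ x₁ u : Multiset Y)) =
      (m x₁ x₂ : Multiset X).bind fun u => (φ u y : Multiset Y)

/-- The unordered pair `[u, v]` in the symmetric square. -/
def pair {X : Type*} (u v : X) : Sym X 2 := ⟨{u, v}, by simp⟩

theorem pair_comm {X : Type*} (u v : X) : pair u v = pair v u :=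
  Subtype.ext (Multiset.pair_comm u v)

/-- The orbit relation of the group `ℤ₂ = {±1}` acting on an abelian group. -/
def signSetoid (G : Type*) [AddCommGroup G] : Setoid G where
  r g h := g = h ∨ g = -h
  iseqv :=
    { refl := fun _ => Or.inl rfl
      symm := by
        rintro x y (h | h)
        · exact Or.inl h.symm
        · exact Or.inr (by rw [h, neg_neg])
      trans := by
        rintro x y z (h | h) (k | k)
        · exact Or.inl (h.trans k)
        · exact Or.inr (h.trans k)
        · exact Or.inr (by rw [h, k])
        · exact Or.inl (by rw [h, k, neg_neg]) }

/-- The underlying set `G / ℤ₂` of the coset group `(G, ℤ₂)`. -/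
def CosetSpace (G : Type*) [AddCommGroup G] : Type _ := Quotient (signSetoid G)

/-- The class `[g] = {g, -g}`. -/
def CosetSpace.mk {G : Type*} [AddCommGroup G] (g : G) : CosetSpace G :=
  Quotient.mk (signSetoid G) g

theorem CosetSpace.mk_neg {G : Type*} [AddCommGroup G] (g : G) :
    CosetSpace.mk (-g) = CosetSpace.mk g :=
  Quotient.sound (s := signSetoid G) (Or.inr rfl)

/-- The operation `[g] * [h] = [[g + h], [g - h]]` of the two-valued coset group `(G, ℤ₂)`. -/
def cosetMul {G : Type*} [AddCommGroup G] (x y : CosetSpace G) : Sym (CosetSpace G) 2 :=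
  Quotient.liftOn₂ x y (fun g h => pair (CosetSpace.mk (g + h)) (CosetSpace.mk (g - h))) (by
    rintro g h g' h' (rfl | rfl) (rfl | rfl)
    · rfl
    · rw [pair_comm]
      congr 2 <;> abel
    · rw [pair_comm, ← CosetSpace.mk_neg (-g' - h), ← CosetSpace.mk_neg (-g' + h)]
      congr 2 <;> abel
    · rw [← CosetSpace.mk_neg (-g' + -h'), ← CosetSpace.mk_neg (-g' - -h')]
      congr 2 <;> abel)

end MultiValued

/-! ## The tangential pencil of conics -/

namespace ConicPencil

open MultiValued

/-- Homogeneous coordinates `(p, q)` of a point of `ℂℙ¹ = ℂ ∪ {∞}`: `ℓ ↦ (ℓ, 1)`, `∞ ↦ (1, 0)`. -/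
def hom : OnePoint ℂ → ℂ × ℂ
  | none => (1, 0)
  | some l => (l, 1)

/-- The matrix of the tangential equation of the conic `C(s)` of the pencil, where `C(0)` is
`a₀w₁² + a₂w₂² + a₄w₃² + 2a₃w₂w₃ + 2a₅w₁w₃ + 2a₁w₁w₂ = 0`, `C(∞)` is `C : w₂² - 4w₁w₃ = 0`, and
`C(s) = C(0) + s C(∞)`. -/
def tangentialMatrix (a : Fin 6 → ℂ) : OnePoint ℂ → Matrix (Fin 3) (Fin 3) ℂ
  | none => !![0, 0, -2; 0, 1, 0; -2, 0, 0]
  | some s => !![a 0, a 1, a 5 - 2 * s; a 1, a 2 + s, a 3; a 5 - 2 * s, a 3, a 4]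

/-- The point equation of `C(s)`: the determinant of the bordered matrix. -/
def pointEq (a : Fin 6 → ℂ) (s : OnePoint ℂ) (z : Fin 3 → ℂ) : ℂ :=
  Matrix.det !![0, z 0, z 1, z 2;
    z 0, tangentialMatrix a s 0 0, tangentialMatrix a s 0 1, tangentialMatrix a s 0 2;
    z 1, tangentialMatrix a s 1 0, tangentialMatrix a s 1 1, tangentialMatrix a s 1 2;
    z 2, tangentialMatrix a s 2 0, tangentialMatrix a s 2 1, tangentialMatrix a s 2 2]

/-- The point `z` lies on the conic `C(s)`. -/
def OnConic (a : Fin 6 → ℂ) (s : OnePoint ℂ) (z : Fin 3 → ℂ) : Prop := pointEq a s z = 0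

/-- `C(s)` is a nondegenerate conic. -/
def Nondegenerate (a : Fin 6 → ℂ) (s : OnePoint ℂ) : Prop := (tangentialMatrix a s).det ≠ 0

/-- The line `z₁ℓ² - 2z₂ℓ + z₃ = 0`, tangent to `C` at the point `(1, ℓ, ℓ²)`. -/
def tangentLine (l : OnePoint ℂ) : Fin 3 → ℂ :=
  ![(hom l).1 ^ 2, -2 * (hom l).1 * (hom l).2, (hom l).2 ^ 2]

/-- The point with Darboux coordinates `(x₁, x₂)`, that is `(1, (x₁ + x₂)/2, x₁x₂)`: the
intersection of the tangents to `C` with parameters `x₁, x₂` (for `x₁ = x₂`, the point of contact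
of this tangent). -/
noncomputable def darbouxPoint (x₁ x₂ : OnePoint ℂ) : Fin 3 → ℂ :=
  ![(hom x₁).2 * (hom x₂).2,
    ((hom x₁).1 * (hom x₂).2 + (hom x₁).2 * (hom x₂).1) / 2,
    (hom x₁).1 * (hom x₂).1]

/-- The line tangent to the (nondegenerate) conic `C(s)` at its point `z`: the polar line of `z`. -/
def tangentAt (a : Fin 6 → ℂ) (s : OnePoint ℂ) (z : Fin 3 → ℂ) : Fin 3 → ℂ :=
  (tangentialMatrix a s).adjugate.mulVec z

/-- Three lines pass through a common point of the projective plane. -/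
def Concurrent (u v w : Fin 3 → ℂ) : Prop :=
  ∃ z : Fin 3 → ℂ, z ≠ 0 ∧ u ⬝ᵥ z = 0 ∧ v ⬝ᵥ z = 0 ∧ w ⬝ᵥ z = 0

/-- The polynomial `P(x) = a₀x⁴ - 4a₁x³ + (2a₅ + 4a₂)x² - 4a₃x + a₄`, homogenized. -/
def quartic (a : Fin 6 → ℂ) (x : OnePoint ℂ) : ℂ :=
  a 0 * (hom x).1 ^ 4 - 4 * a 1 * (hom x).1 ^ 3 * (hom x).2
    + (2 * a 5 + 4 * a 2) * (hom x).1 ^ 2 * (hom x).2 ^ 2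
    - 4 * a 3 * (hom x).1 * (hom x).2 ^ 3 + a 4 * (hom x).2 ^ 4

/-- The tangent to `C` with parameter `l` is tangent to all conics of the pencil. -/
def IsCommonTangent (a : Fin 6 → ℂ) (l : OnePoint ℂ) : Prop :=
  ∀ s : OnePoint ℂ, tangentLine l ⬝ᵥ (tangentialMatrix a s).mulVec (tangentLine l) = 0

/-- General position: the conics of the pencil share exactly four (distinct) common tangents. -/
def GeneralPosition (a : Fin 6 → ℂ) : Prop := {l : OnePoint ℂ | IsCommonTangent a l}.ncard = 4

theorem isCommonTangent_iff (a : Fin 6 → ℂ) (l : OnePoint ℂ) :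
    IsCommonTangent a l ↔ quartic a l = 0 := by
  constructor
  · intro h
    have := h (some 0)
    simp [tangentialMatrix, tangentLine, dotProduct, Matrix.mulVec, Fin.sum_univ_three] at this
    rw [← this, quartic]
    ring
  · rintro h (_ | s)
    · simp [tangentialMatrix, tangentLine, dotProduct, Matrix.mulVec, Fin.sum_univ_three]
      ring
    · rw [← h, quartic]
      simp [tangentialMatrix, tangentLine, dotProduct, Matrix.mulVec, Fin.sum_univ_three]
      ring

/-- The tangents to `C` are exactly the lines `tangentLine l`. -/
theorem tangent_iff (a : Fin 6 → ℂ) (w : Fin 3 → ℂ) (hw : w ≠ 0) :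
    w ⬝ᵥ (tangentialMatrix a none).mulVec w = 0 ↔
      ∃ (l : OnePoint ℂ) (c : ℂ), c ≠ 0 ∧ w = c • tangentLine l := by
  have key : w ⬝ᵥ (tangentialMatrix a none).mulVec w = w 1 ^ 2 - 4 * w 0 * w 2 := by
    simp [tangentialMatrix, dotProduct, Matrix.mulVec, Fin.sum_univ_three]
    ring
  rw [key]
  constructor
  · intro h
    by_cases h2 : w 2 = 0
    · have h1 : w 1 = 0 := by simpa [h2] using h
      have h0 : w 0 ≠ 0 := by
        intro h0
        apply hw
        ext i
        fin_cases i <;> simp [h0, h1, h2]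
      refine ⟨none, w 0, h0, ?_⟩
      ext i
      fin_cases i <;> simp [tangentLine, hom, h1, h2]
    · refine ⟨some (-(w 1) / (2 * w 2)), w 2, h2, ?_⟩
      ext i
      fin_cases i
      · simp [tangentLine, hom]
        field_simp
        linear_combination -h
      · simp [tangentLine, hom]
        field_simp
      · simp [tangentLine, hom]
  · rintro ⟨l, c, -, rfl⟩
    simp [tangentLine]
    ring

/-- The Darboux point lies on both tangents. -/
theorem darbouxPoint_mem (x₁ x₂ : OnePoint ℂ) :
    tangentLine x₁ ⬝ᵥ darbouxPoint x₁ x₂ = 0 ∧ tangentLine x₂ ⬝ᵥ darbouxPoint x₁ x₂ = 0 := by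
  constructor <;>
  · simp [tangentLine, darbouxPoint, dotProduct, Fin.sum_univ_three]
    ring

/-- The polar line of a point of `C(s)` passes through it and is tangent to `C(s)`. -/
theorem tangentAt_spec (a : Fin 6 → ℂ) (s : OnePoint ℂ) (z : Fin 3 → ℂ) :
    tangentAt a s z ⬝ᵥ z = -pointEq a s z ∧
      tangentAt a s z ⬝ᵥ (tangentialMatrix a s).mulVec (tangentAt a s z) =
        -((tangentialMatrix a s).det * pointEq a s z) := by
  have h1 : tangentAt a s z ⬝ᵥ z = -pointEq a s z := by
    unfold tangentAt pointEq
    generalize tangentialMatrix a s = A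
    simp [Matrix.adjugate_fin_three, Matrix.det_succ_row_zero, dotProduct, Matrix.mulVec,
      Fin.sum_univ_succ, Fin.succAbove]
    ring
  refine ⟨h1, ?_⟩
  have h2 : (tangentialMatrix a s).mulVec (tangentAt a s z) = (tangentialMatrix a s).det • z := by
    rw [tangentAt, Matrix.mulVec_mulVec, Matrix.mul_adjugate, Matrix.smul_mulVec, Matrix.one_mulVec]
  rw [h2, dotProduct_smul, h1, smul_eq_mul]
  ring

/-! ### The Great Poncelet Theorem for triangles -/

/-- The tangents to `C(s₁), C(s₂), C(s₃)` at the points of intersection `a₁ ∩ a₂`, `a₂ ∩ a₃`,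
`a₁ ∩ a₃` are not concurrent; here `a₁, a₂, a₃` are tangents to `C` given by their parameters. -/
def VertexTangentsNotConcurrent (a : Fin 6 → ℂ) (s₁ s₂ s₃ a₁ a₂ a₃ : OnePoint ℂ) : Prop :=
  ¬ Concurrent (tangentAt a s₁ (darbouxPoint a₁ a₂)) (tangentAt a s₂ (darbouxPoint a₂ a₃))
    (tangentAt a s₃ (darbouxPoint a₁ a₃))

/-- The tangents `a₁, a₂, a₃` to `C` are pairwise distinct, `a₁, a₂` intersect on `C(s₁)`,
`a₂, a₃` on `C(s₂)`, `a₁, a₃` on `C(s₃)`, and the tangents to these conics at the intersection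
points are not concurrent. -/
structure IsPonceletTriangle (a : Fin 6 → ℂ) (s₁ s₂ s₃ a₁ a₂ a₃ : OnePoint ℂ) : Prop where
  ne₁₂ : a₁ ≠ a₂
  ne₂₃ : a₂ ≠ a₃
  ne₁₃ : a₁ ≠ a₃
  on₁ : OnConic a s₁ (darbouxPoint a₁ a₂)
  on₂ : OnConic a s₂ (darbouxPoint a₂ a₃)
  on₃ : OnConic a s₃ (darbouxPoint a₁ a₃)
  not_concurrent : VertexTangentsNotConcurrent a s₁ s₂ s₃ a₁ a₂ a₃

/-- The Great Poncelet Theorem for triangles, for the pencil: if there is one Poncelet triangle for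
nondegenerate conics `C(s₁), C(s₂), C(s₃)`, then every pair of tangents `b₁, b₂` to `C` meeting on
`C(s₁)` is completed by a tangent `b₃` meeting `b₂` on `C(s₂)` and `b₁` on `C(s₃)`; it is again a
Poncelet triangle unless it is degenerate (two sides coincide or a side is a common tangent of the
whole pencil, when the vertices, respectively the tangents at them, are not in general position). -/
def GreatPonceletForTriangles (a : Fin 6 → ℂ) : Prop :=
  ∀ s₁ s₂ s₃ : OnePoint ℂ, Nondegenerate a s₁ → Nondegenerate a s₂ → Nondegenerate a s₃ →
    ∀ a₁ a₂ a₃ : OnePoint ℂ, IsPonceletTriangle a s₁ s₂ s₃ a₁ a₂ a₃ →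
      ∀ b₁ b₂ : OnePoint ℂ, OnConic a s₁ (darbouxPoint b₁ b₂) →
        ∃ b₃ : OnePoint ℂ, OnConic a s₂ (darbouxPoint b₂ b₃) ∧ OnConic a s₃ (darbouxPoint b₁ b₃) ∧
          (b₁ ≠ b₂ → b₂ ≠ b₃ → b₁ ≠ b₃ →
            ¬ IsCommonTangent a b₁ → ¬ IsCommonTangent a b₂ → ¬ IsCommonTangent a b₃ →
              IsPonceletTriangle a s₁ s₂ s₃ b₁ b₂ b₃)

/-- The triple of conics `C(s₁), C(s₂), C(s₃)` is poristic with respect to `C`: every pair of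
tangents to `C` meeting on `C(s₁)` is completed to a triangle of tangents to `C` with the other
two vertices on `C(s₂)` and `C(s₃)`. -/
def IsPoristic (a : Fin 6 → ℂ) (s₁ s₂ s₃ : OnePoint ℂ) : Prop :=
  ∀ b₁ b₂ : OnePoint ℂ, OnConic a s₁ (darbouxPoint b₁ b₂) →
    ∃ b₃ : OnePoint ℂ, OnConic a s₂ (darbouxPoint b₂ b₃) ∧ OnConic a s₃ (darbouxPoint b₁ b₃)

/-! ### The curves `Γ₁` and `Γ₂` -/

/-- The (smooth, complete) curve `Γ₁ : y² = P(x)`; over `x = ∞` its points are the `y` with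
`y² = a₀`. -/
@[ext]
structure Gamma1 (a : Fin 6 → ℂ) where
  x : OnePoint ℂ
  y : ℂ
  eq : y ^ 2 = quartic a x

/-- The cubic `J(s)`. -/
def cubic (a : Fin 6 → ℂ) (s : ℂ) : ℂ :=
  -4 * s ^ 3 + 4 * (a 5 - a 2) * s ^ 2
    + (a 0 * a 4 - a 5 ^ 2 + 4 * (a 5 * a 2 - a 1 * a 3)) * s
    + (-a 3 ^ 2 * a 0 + a 0 * a 4 * a 2 + 2 * a 1 * a 3 * a 5 - a 4 * a 1 ^ 2 - a 2 * a 5 ^ 2)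

theorem det_tangentialMatrix (a : Fin 6 → ℂ) (s : ℂ) :
    (tangentialMatrix a (some s)).det = cubic a s := by
  simp [tangentialMatrix, cubic, Matrix.det_fin_three]
  ring

/-- The curve `Γ₂ : t² = J(s)` in the Weierstrass coordinates `X = -s`, `Y = t / 2`. -/
noncomputable def gamma2Curve (a : Fin 6 → ℂ) : WeierstrassCurve ℂ where
  a₁ := 0
  a₂ := a 5 - a 2
  a₃ := 0
  a₄ := -(a 0 * a 4 - a 5 ^ 2 + 4 * (a 5 * a 2 - a 1 * a 3)) / 4
  a₆ := (-a 3 ^ 2 * a 0 + a 0 * a 4 * a 2 + 2 * a 1 * a 3 * a 5 - a 4 * a 1 ^ 2 - a 2 * a 5 ^ 2) / 4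

theorem gamma2Curve_equation (a : Fin 6 → ℂ) (s t : ℂ) :
    (gamma2Curve a).toAffine.Equation (-s) (t / 2) ↔ t ^ 2 = cubic a s := by
  rw [WeierstrassCurve.Affine.equation_iff]
  simp only [gamma2Curve, cubic]
  constructor <;> intro h
  · linear_combination 4 * h
  · linear_combination h / 4

/-- The points of `Γ₂`, with the group law of a plane cubic whose zero is the point at infinity. -/
abbrev Gamma2 (a : Fin 6 → ℂ) : Type := (gamma2Curve a).toAffine.Point

/-- The coordinate `s` on `Γ₂`; it takes the value `∞` at the point at infinity. -/
noncomputable def sCoord (a : Fin 6 → ℂ) : Gamma2 a → OnePoint ℂ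
  | .zero => none
  | .some X _ _ => some (-X)

/-- The set of elements of the two-valued coset group `(Γ₂, ℤ₂)`. -/
abbrev CosetGroup (a : Fin 6 → ℂ) : Type := CosetSpace (Gamma2 a)

/-- The operation of the two-valued coset group `(Γ₂, ℤ₂)`. -/
noncomputable def groupOp (a : Fin 6 → ℂ) (P Q : CosetGroup a) : Sym (CosetGroup a) 2 :=
  cosetMul P Q

/-- The coordinate `s : Γ₂ / ℤ₂ → ℂℙ¹`, i.e. the parameter of the conic `C_P` of the pencil which
corresponds to the element `P` of the two-valued group. -/
noncomputable def pencilParam (a : Fin 6 → ℂ) (P : CosetGroup a) : OnePoint ℂ :=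
  Quotient.liftOn P (sCoord a) (by
    rintro (_ | ⟨X, Y, h⟩) Q (rfl | hQ)
    · rfl
    · rw [eq_neg_iff_add_eq_zero, ← WeierstrassCurve.Affine.Point.zero_def, zero_add] at hQ
      subst hQ
      rfl
    · rfl
    · obtain rfl := neg_eq_iff_eq_neg.mpr hQ
      rfl)

/-! ### The action of `(Γ₂, ℤ₂)` on `Γ₁` by the pencil equation -/

/-- The coefficients of the pencil equation `F(s, x₁, x₂) = L s² + K s + H` in Darboux coordinates
(homogenized in `x₁` and in `x₂`). -/
noncomputable def coeffL (a : Fin 6 → ℂ) (x₁ x₂ : OnePoint ℂ) : ℂ :=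
  pointEq a none (darbouxPoint x₁ x₂)

/-- See `coeffL`. -/
noncomputable def coeffH (a : Fin 6 → ℂ) (x₁ x₂ : OnePoint ℂ) : ℂ :=
  pointEq a (some 0) (darbouxPoint x₁ x₂)

/-- See `coeffL`. -/
noncomputable def coeffK (a : Fin 6 → ℂ) (x₁ x₂ : OnePoint ℂ) : ℂ :=
  pointEq a (some 1) (darbouxPoint x₁ x₂) - coeffL a x₁ x₂ - coeffH a x₁ x₂

theorem pointEq_eq (a : Fin 6 → ℂ) (s : ℂ) (x₁ x₂ : OnePoint ℂ) :
    pointEq a (some s) (darbouxPoint x₁ x₂) =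
      coeffL a x₁ x₂ * s ^ 2 + coeffK a x₁ x₂ * s + coeffH a x₁ x₂ := by
  unfold coeffK coeffL coeffH pointEq
  generalize darbouxPoint x₁ x₂ = z
  simp [tangentialMatrix, Matrix.det_succ_row_zero, Fin.sum_univ_succ, Fin.succAbove]
  ring

/-- The discriminant of the pencil equation in `s` separates: it equals `P(x₁)P(x₂)`. -/
theorem discrim_eq (a : Fin 6 → ℂ) (x₁ x₂ : OnePoint ℂ) :
    coeffK a x₁ x₂ ^ 2 - 4 * coeffL a x₁ x₂ * coeffH a x₁ x₂ = quartic a x₁ * quartic a x₂ := by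
  unfold coeffK coeffL coeffH pointEq quartic darbouxPoint
  simp [tangentialMatrix, Matrix.det_succ_row_zero, Fin.sum_univ_succ, Fin.succAbove]
  ring

/-- The sign condition that selects, over a solution of the pencil equation `F(s, x₁, x₂) = 0`, one
of the two branches of `(∂F/∂s)² = P(x₁)P(x₂) = (y₁y₂)²`, namely `∂F/∂s = y₁y₂`, in homogeneous form
for `s = ∞`. The branch is the one for which the unit `s = ∞` acts as the identity. -/
noncomputable def BranchCondition (a : Fin 6 → ℂ) (M N : Gamma1 a) : OnePoint ℂ → Prop
  | none => -coeffK a M.x N.x = M.y * N.y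
  | some s => 2 * coeffL a M.x N.x * s + coeffK a M.x N.x = M.y * N.y

/-- `N` is one of the values of `P ∘ M`: the tangents `l_M`, `l_N` to `C` intersect on the conic
`C_P`, i.e. `F(s, x₁, x₂) = 0`, and the points `M`, `N` of `Γ₁` lie on the same branch. -/
def IsValue (a : Fin 6 → ℂ) (P : CosetGroup a) (M N : Gamma1 a) : Prop :=
  OnConic a (pencilParam a P) (darbouxPoint M.x N.x) ∧ BranchCondition a M N (pencilParam a P)

open Classical in
/-- The two-valued action `P ∘ M = [N₁, N₂]` of `(Γ₂, ℤ₂)` on `Γ₁`, where `N₁, N₂` are the values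
given by the pencil equation (`N₁ = N₂` if there is only one). -/
noncomputable def pencilAction (a : Fin 6 → ℂ) (P : CosetGroup a) (M : Gamma1 a) :
    Sym (Gamma1 a) 2 :=
  if h : ∃ N : Gamma1 a × Gamma1 a, {K | IsValue a P M K} = {N.1, N.2} then
    pair h.choose.1 h.choose.2
  else pair M M

end ConicPencil

/-! ## Collinear points on a Weierstrass cubic `Y² = X³ + a₂X² + a₄X + a₆` -/

namespace WeierstrassCurve.Affine

/-- The symmetric biquadratic relation between the abscissae of three collinear points of the cubic
`Y² = X³ + a₂X² + a₄X + a₆`. -/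
def triquadratic (W : WeierstrassCurve.Affine ℂ) (x₁ x₂ x₃ : ℂ) : ℂ :=
  (x₁ * x₂ + x₁ * x₃ + x₂ * x₃ - W.a₄) ^ 2 - 4 * (x₁ + x₂ + x₃ + W.a₂) * (x₁ * x₂ * x₃ + W.a₆)

/-- The derivative of `triquadratic` with respect to its first argument. -/
def triquadraticDeriv (W : WeierstrassCurve.Affine ℂ) (x₁ x₂ x₃ : ℂ) : ℂ :=
  2 * (x₁ * x₂ + x₁ * x₃ + x₂ * x₃ - W.a₄) * (x₂ + x₃) - 4 * (x₁ * x₂ * x₃ + W.a₆)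
    - 4 * (x₁ + x₂ + x₃ + W.a₂) * (x₂ * x₃)

/-- The line `Y = lX + m` meets the cubic at the points with abscissae `x₁, x₂, x₃`, counted with
multiplicities. -/
structure LineMeets (W : WeierstrassCurve.Affine ℂ) (l m x₁ x₂ x₃ : ℂ) : Prop where
  sum : x₁ + x₂ + x₃ + W.a₂ = l ^ 2
  sum_mul : x₁ * x₂ + x₁ * x₃ + x₂ * x₃ - W.a₄ = -2 * l * m
  prod : x₁ * x₂ * x₃ + W.a₆ = m ^ 2

variable {W : WeierstrassCurve.Affine ℂ} {l m x₁ x₂ x₃ y₁ y₂ y₃ : ℂ}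

theorem LineMeets.triquadratic_eq_zero (h : W.LineMeets l m x₁ x₂ x₃) :
    W.triquadratic x₁ x₂ x₃ = 0 := by
  rw [triquadratic, h.sum, h.sum_mul, h.prod]
  ring

theorem LineMeets.triquadraticDeriv_eq (h : W.LineMeets l m x₁ x₂ x₃) :
    W.triquadraticDeriv x₁ x₂ x₃ = -4 * ((l * x₂ + m) * (l * x₃ + m)) := by
  rw [triquadraticDeriv, h.sum, h.sum_mul, h.prod]
  ring

theorem LineMeets.neg (h : W.LineMeets l m x₁ x₂ x₃) : W.LineMeets (-l) (-m) x₁ x₂ x₃ :=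
  ⟨by rw [h.sum]; ring, by rw [h.sum_mul]; ring, by rw [h.prod]; ring⟩

theorem LineMeets.rotate (h : W.LineMeets l m x₁ x₂ x₃) : W.LineMeets l m x₂ x₃ x₁ :=
  ⟨by rw [← h.sum]; ring, by rw [← h.sum_mul]; ring, by rw [← h.prod]; ring⟩

theorem LineMeets.sq_eq (h : W.LineMeets l m x₁ x₂ x₃) :
    (l * x₁ + m) ^ 2 = x₁ ^ 3 + W.a₂ * x₁ ^ 2 + W.a₄ * x₁ + W.a₆ := by
  linear_combination -x₁ ^ 2 * h.sum + x₁ * h.sum_mul - h.prod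

theorem exists_lineMeets (h : W.triquadratic x₁ x₂ x₃ = 0) : ∃ l m, W.LineMeets l m x₁ x₂ x₃ := by
  obtain ⟨l, hl⟩ := IsAlgClosed.exists_pow_nat_eq (x₁ + x₂ + x₃ + W.a₂) two_pos
  rw [triquadratic, ← hl] at h
  rcases eq_or_ne l 0 with rfl | h0
  · obtain ⟨m, hm⟩ := IsAlgClosed.exists_pow_nat_eq (x₁ * x₂ * x₃ + W.a₆) two_pos
    refine ⟨0, m, hl.symm, ?_, hm.symm⟩
    have h' : (x₁ * x₂ + x₁ * x₃ + x₂ * x₃ - W.a₄) ^ 2 = 0 := by linear_combination h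
    rw [pow_eq_zero_iff two_ne_zero] at h'
    rw [h']
    ring
  · refine ⟨l, -(x₁ * x₂ + x₁ * x₃ + x₂ * x₃ - W.a₄) / (2 * l), hl.symm, ?_, ?_⟩
    · field_simp
    · field_simp
      linear_combination -h

theorem equation_short_iff (h₁ : W.a₁ = 0) (h₃ : W.a₃ = 0) (x y : ℂ) :
    W.Equation x y ↔ y ^ 2 = x ^ 3 + W.a₂ * x ^ 2 + W.a₄ * x + W.a₆ := by
  rw [equation_iff, h₁, h₃]
  simp

theorem nonsingular_short_iff (h₁ : W.a₁ = 0) (h₃ : W.a₃ = 0) (x y : ℂ) :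
    W.Nonsingular x y ↔ y ^ 2 = x ^ 3 + W.a₂ * x ^ 2 + W.a₄ * x + W.a₆ ∧
      (y = 0 → 3 * x ^ 2 + 2 * W.a₂ * x + W.a₄ ≠ 0) := by
  rw [nonsingular_iff', equation_short_iff h₁ h₃, h₁, h₃]
  simp only [zero_mul, zero_sub, add_zero, ne_eq, neg_eq_zero, mul_eq_zero, OfNat.ofNat_ne_zero,
    false_or]
  tauto

theorem negY_short (h₁ : W.a₁ = 0) (h₃ : W.a₃ = 0) (x y : ℂ) : W.negY x y = -y := by
  simp [negY, h₁, h₃]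

/-- Three points on a line add up to zero. -/
theorem LineMeets.add_eq_zero (h₁ : W.a₁ = 0) (h₃ : W.a₃ = 0) (h : W.LineMeets l m x₁ x₂ x₃)
    {n₁ : W.Nonsingular x₁ y₁} {n₂ : W.Nonsingular x₂ y₂} {n₃ : W.Nonsingular x₃ y₃}
    (hy₁ : y₁ = l * x₁ + m) (hy₂ : y₂ = l * x₂ + m) (hy₃ : y₃ = l * x₃ + m) :
    Point.some _ _ n₁ + Point.some _ _ n₂ + Point.some _ _ n₃ = 0 := by
  have key : ¬(x₁ = x₂ ∧ y₁ = W.negY x₂ y₂) ∧ W.slope x₁ x₂ y₁ y₂ = l := by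
    rw [negY_short h₁ h₃]
    by_cases hx : x₁ = x₂
    · subst hx
      have hyy : y₁ = y₂ := hy₁.trans hy₂.symm
      subst hyy
      have hd : 3 * x₁ ^ 2 + 2 * W.a₂ * x₁ + W.a₄ = 2 * l * y₁ := by
        linear_combination 2 * x₁ * h.sum - h.sum_mul - 2 * l * hy₁
      have hy0 : y₁ ≠ 0 := by
        intro h0
        refine ((nonsingular_short_iff h₁ h₃ _ _).1 n₁).2 h0 ?_
        rw [hd, h0, mul_zero]
      have hne : y₁ ≠ -y₁ := by
        intro h
        exact hy0 (by linear_combination h / 2)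
      refine ⟨fun h => hne h.2, ?_⟩
      rw [slope_of_Y_ne rfl (by rwa [negY_short h₁ h₃]), negY_short h₁ h₃, h₁, hd]
      field_simp
      ring
    · refine ⟨fun h => hx h.1, ?_⟩
      rw [slope_of_X_ne hx, hy₁, hy₂, div_eq_iff (sub_ne_zero.2 hx)]
      ring
  rw [Point.add_some key.1, add_eq_zero_iff_eq_neg, Point.neg_some]
  simp only [Point.some.injEq]
  rw [key.2, negY_short h₁ h₃]
  have hX : W.addX x₁ x₂ l = x₃ := by
    rw [addX, h₁]
    linear_combination -h.sum
  refine ⟨hX, ?_⟩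
  rw [addY, negAddY, hX, negY_short h₁ h₃, hy₁, hy₃]
  ring

/-- Three points adding up to zero are on a line. -/
theorem exists_lineMeets_of_add_eq_zero (h₁ : W.a₁ = 0) (h₃ : W.a₃ = 0)
    {n₁ : W.Nonsingular x₁ y₁} {n₂ : W.Nonsingular x₂ y₂} {n₃ : W.Nonsingular x₃ y₃}
    (h : Point.some _ _ n₁ + Point.some _ _ n₂ + Point.some _ _ n₃ = 0) :
    ∃ l m, W.LineMeets l m x₁ x₂ x₃ ∧ y₂ = l * x₂ + m ∧ y₃ = l * x₃ + m := by
  by_cases hxy : x₁ = x₂ ∧ y₁ = W.negY x₂ y₂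
  · rw [Point.add_of_Y_eq hxy.1 hxy.2, zero_add] at h
    exact absurd h (Point.some_ne_zero n₃)
  rw [Point.add_some hxy, add_eq_zero_iff_eq_neg, Point.neg_some] at h
  simp only [Point.some.injEq] at h
  obtain ⟨hX, hY⟩ := h
  have hpoly := addPolynomial_slope n₁.1 n₂.1 hxy
  rw [hX, addPolynomial_eq, neg_inj, Cubic.prod_X_sub_C_eq, Cubic.toPoly_injective,
    Cubic.mk.injEq] at hpoly
  obtain ⟨-, hb, hc, hd⟩ := hpoly
  have hy₂ : y₂ = W.slope x₁ x₂ y₁ y₂ * x₂ + (y₁ - W.slope x₁ x₂ y₁ y₂ * x₁) := by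
    by_cases hx : x₁ = x₂
    · subst hx
      have := Y_eq_of_Y_ne n₁.1 n₂.1 rfl (fun h => hxy ⟨rfl, h⟩)
      rw [this]
      ring
    · have := sub_ne_zero.2 hx
      rw [slope_of_X_ne hx]
      field_simp
      ring
  rw [addY, negAddY, hX, negY_short h₁ h₃, negY_short h₁ h₃] at hY
  generalize W.slope x₁ x₂ y₁ y₂ = l at *
  simp only [h₁, h₃] at hb hc hd
  exact ⟨l, y₁ - l * x₁, ⟨by linear_combination hb, by linear_combination -hc,
    by linear_combination hd⟩, hy₂, by linear_combination hY⟩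

/-- `P₃ = P₂ ± P₁` in terms of the biquadratic relation between the abscissae. -/
theorem triquadratic_iff (h₁ : W.a₁ = 0) (h₃ : W.a₃ = 0)
    (n₁ : W.Nonsingular x₁ y₁) (n₂ : W.Nonsingular x₂ y₂) (n₃ : W.Nonsingular x₃ y₃) :
    W.triquadratic x₁ x₂ x₃ = 0 ∧ W.triquadraticDeriv x₁ x₂ x₃ = 4 * (y₂ * y₃) ↔
      Point.some _ _ n₃ = Point.some _ _ n₂ + Point.some _ _ n₁ ∨
        Point.some _ _ n₃ = Point.some _ _ n₂ - Point.some _ _ n₁ := by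
  have neg_some' : ∀ {x y : ℂ} (n : W.Nonsingular x y), ∃ n' : W.Nonsingular x (-y),
      Point.some _ _ n' = -Point.some _ _ n := by
    intro x y n
    have hY := negY_short h₁ h₃ x y
    have n' := (nonsingular_neg x y).2 n
    rw [hY] at n'
    refine ⟨n', ?_⟩
    rw [Point.neg_some]
    simp [h₁, h₃]
  obtain ⟨m₁, hm₁⟩ := neg_some' n₁
  obtain ⟨m₃, hm₃⟩ := neg_some' n₃
  have back : ∀ {y : ℂ} (n : W.Nonsingular x₁ y),
      Point.some _ _ n₃ = Point.some _ _ n₂ + Point.some _ _ n →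
        W.triquadratic x₁ x₂ x₃ = 0 ∧ W.triquadraticDeriv x₁ x₂ x₃ = 4 * (y₂ * y₃) := by
    intro y n h
    have hs : Point.some _ _ n + Point.some _ _ n₂ + Point.some _ _ m₃ = 0 := by
      rw [hm₃, h]
      abel
    obtain ⟨l, m, hl, hy₂, hy₃⟩ := exists_lineMeets_of_add_eq_zero h₁ h₃ hs
    refine ⟨hl.triquadratic_eq_zero, ?_⟩
    rw [hl.triquadraticDeriv_eq, ← hy₂, ← hy₃]
    ring
  constructor
  · rintro ⟨h, hd⟩
    obtain ⟨l, m, hl⟩ := exists_lineMeets h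
    have sq : ∀ {x y : ℂ}, W.Nonsingular x y →
        (l * x + m) ^ 2 = x ^ 3 + W.a₂ * x ^ 2 + W.a₄ * x + W.a₆ →
          y = l * x + m ∨ y = -(l * x + m) :=
      fun n e => sq_eq_sq_iff_eq_or_eq_neg.1
        (((nonsingular_short_iff h₁ h₃ _ _).1 n).1.trans e.symm)
    have fin : ∀ {l m : ℂ}, W.LineMeets l m x₁ x₂ x₃ → (y₁ = l * x₁ + m ∨ y₁ = -(l * x₁ + m)) →
        y₂ = l * x₂ + m → -y₃ = l * x₃ + m →
        Point.some _ _ n₃ = Point.some _ _ n₂ + Point.some _ _ n₁ ∨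
          Point.some _ _ n₃ = Point.some _ _ n₂ - Point.some _ _ n₁ := by
      intro l m hl hy₁ hy₂ hy₃
      rcases hy₁ with hy₁ | hy₁
      · left
        have := hl.add_eq_zero h₁ h₃ (n₁ := n₁) (n₂ := n₂) (n₃ := m₃) hy₁ hy₂ hy₃
        rw [hm₃, add_neg_eq_zero] at this
        rw [← this, add_comm]
      · right
        have := hl.add_eq_zero h₁ h₃ (n₁ := m₁) (n₂ := n₂) (n₃ := m₃)
          (by rw [hy₁, neg_neg]) hy₂ hy₃
        rw [hm₁, hm₃, add_neg_eq_zero] at this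
        rw [← this, neg_add_eq_sub]
    have e₁ := sq n₁ hl.sq_eq
    have e₂ := sq n₂ hl.rotate.sq_eq
    have e₃ := sq n₃ hl.rotate.rotate.sq_eq
    rw [hl.triquadraticDeriv_eq] at hd
    have hprod : y₂ * y₃ = -((l * x₂ + m) * (l * x₃ + m)) := by linear_combination -hd / 4
    have cases : (y₂ = l * x₂ + m ∧ -y₃ = l * x₃ + m) ∨
        (y₂ = -(l * x₂ + m) ∧ y₃ = l * x₃ + m) := by
      rcases e₂ with e₂ | e₂ <;> rcases e₃ with e₃ | e₃
      · have : y₂ * y₃ = 0 := by rw [← e₂, ← e₃] at hprod; linear_combination hprod / 2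
        rcases mul_eq_zero.1 this with h0 | h0
        · exact Or.inr ⟨by rw [← e₂, h0, neg_zero], e₃⟩
        · exact Or.inl ⟨e₂, by rw [← e₃, h0, neg_zero]⟩
      · exact Or.inl ⟨e₂, by rw [e₃, neg_neg]⟩
      · exact Or.inr ⟨e₂, e₃⟩
      · have : y₂ * y₃ = 0 := by
          have a : l * x₂ + m = -y₂ := by rw [e₂, neg_neg]
          have b : l * x₃ + m = -y₃ := by rw [e₃, neg_neg]
          rw [a, b] at hprod
          linear_combination hprod / 2
        rcases mul_eq_zero.1 this with h0 | h0
        · exact Or.inl ⟨by linear_combination 2 * h0 - e₂, by rw [e₃, neg_neg]⟩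
        · exact Or.inr ⟨e₂, by linear_combination 2 * h0 - e₃⟩
    rcases cases with ⟨c₂, c₃⟩ | ⟨c₂, c₃⟩
    · exact fin hl e₁ c₂ c₃
    · refine fin hl.neg ?_ (by rw [c₂]; ring) (by rw [c₃]; ring)
      rcases e₁ with e₁ | e₁
      · exact Or.inr (by rw [e₁]; ring)
      · exact Or.inl (by rw [e₁]; ring)
  · rintro (h | h)
    · exact back n₁ h
    · exact back m₁ (by rw [h, hm₁, sub_eq_add_neg])

/-- A point of a short Weierstrass cubic over `ℂ` has finitely many halves. -/
theorem finite_add_self_eq (h₁ : W.a₁ = 0) (h₃ : W.a₃ = 0) (c : W.Point) :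
    {g : W.Point | g + g = c}.Finite := by
  have two : {g : W.Point | g + g = 0}.Finite := by
    let f : Polynomial ℂ := Cubic.toPoly ⟨1, W.a₂, W.a₄, W.a₆⟩
    have hf : f ≠ 0 := Cubic.ne_zero_of_a_ne_zero one_ne_zero
    have hsub : ({g : W.Point | g + g = 0} \ {0}).Finite := by
      refine Set.Finite.of_finite_image (f := fun g : W.Point => g.xRep 0)
        ((f.roots.toFinset.finite_toSet).subset ?_) ?_
      · rintro _ ⟨_ | ⟨x, y, n⟩, ⟨hg, h0⟩, rfl⟩
        · exact absurd rfl h0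
        · have hy : y = 0 := by
            rw [Set.mem_ofPred_eq, add_eq_zero_iff_eq_neg, Point.neg_some] at hg
            simp only [Point.some.injEq, negY_short h₁ h₃, true_and] at hg
            linear_combination hg / 2
          have := ((nonsingular_short_iff h₁ h₃ _ _).1 n).1
          rw [Finset.mem_coe, Multiset.mem_toFinset, Polynomial.mem_roots hf, Polynomial.IsRoot]
          simp only [f, Cubic.toPoly, Point.xRep_some, Matrix.cons_val_zero, Polynomial.eval_add,
            Polynomial.eval_mul, Polynomial.eval_C, Polynomial.eval_pow, Polynomial.eval_X]
          rw [one_mul, ← this, hy]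
          ring
      · rintro g ⟨hg, h0⟩ g' ⟨hg', h0'⟩ he
        rcases g with _ | ⟨x, y, n⟩
        · exact absurd rfl h0
        rcases g' with _ | ⟨x', y', n'⟩
        · exact absurd rfl h0'
        simp only [Point.xRep_some, Matrix.cons_val_zero] at he
        rcases Point.X_eq_iff.1 he with h | h
        · exact h
        · rw [h]
          exact (eq_neg_of_add_eq_zero_left hg').symm
    exact (hsub.union (Set.finite_singleton 0)).subset (by
      intro g hg
      by_cases h : g = 0
      · exact Or.inr h
      · exact Or.inl ⟨hg, h⟩)
  rcases Set.eq_empty_or_nonempty {g : W.Point | g + g = c} with h | ⟨g₀, hg₀⟩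
  · rw [h]
    exact Set.finite_empty
  · refine (two.image (fun g => g + g₀)).subset ?_
    intro g hg
    refine ⟨g - g₀, ?_, sub_add_cancel g g₀⟩
    have h1 : g + g = c := hg
    have h2 : g₀ + g₀ = c := hg₀
    show g - g₀ + (g - g₀) = 0
    rw [sub_add_sub_comm, h1, h2, sub_self]

end WeierstrassCurve.Affine

namespace ConicPencil

open MultiValued WeierstrassCurve.Affine

/-! ## Explicit formulas -/

@[simp]
theorem hom_coe (l : ℂ) : hom (l : OnePoint ℂ) = (l, 1) := rfl

@[simp]
theorem hom_infty : hom OnePoint.infty = (1, 0) := rfl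

theorem pointEq_some (a : Fin 6 → ℂ) (s : ℂ) (z : Fin 3 → ℂ) :
    pointEq a (s : OnePoint ℂ) z =
      -(((a 2 + s) * a 4 - a 3 ^ 2) * z 0 ^ 2 + (a 0 * a 4 - (a 5 - 2 * s) ^ 2) * z 1 ^ 2
        + (a 0 * (a 2 + s) - a 1 ^ 2) * z 2 ^ 2
        + 2 * (a 3 * (a 5 - 2 * s) - a 1 * a 4) * z 0 * z 1
        + 2 * (a 1 * a 3 - (a 2 + s) * (a 5 - 2 * s)) * z 0 * z 2
        + 2 * (a 1 * (a 5 - 2 * s) - a 0 * a 3) * z 1 * z 2) := by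
  have h : tangentialMatrix a (s : OnePoint ℂ) =
      !![a 0, a 1, a 5 - 2 * s; a 1, a 2 + s, a 3; a 5 - 2 * s, a 3, a 4] := rfl
  simp [pointEq, h, Matrix.det_succ_row_zero, Fin.sum_univ_succ, Fin.succAbove]
  ring

theorem coeffL_eq (a : Fin 6 → ℂ) (x₁ x₂ : OnePoint ℂ) :
    coeffL a x₁ x₂ = ((hom x₁).1 * (hom x₂).2 - (hom x₁).2 * (hom x₂).1) ^ 2 := by
  simp [coeffL, darbouxPoint, pointEq, tangentialMatrix, Matrix.det_succ_row_zero,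
    Fin.sum_univ_succ, Fin.succAbove]
  ring

theorem coeffK_eq (a : Fin 6 → ℂ) (x₁ x₂ : OnePoint ℂ) :
    coeffK a x₁ x₂ =
      -(a 4 * darbouxPoint x₁ x₂ 0 ^ 2 + 4 * a 5 * darbouxPoint x₁ x₂ 1 ^ 2
        + a 0 * darbouxPoint x₁ x₂ 2 ^ 2 - 4 * a 3 * darbouxPoint x₁ x₂ 0 * darbouxPoint x₁ x₂ 1
        - 2 * (a 5 - 2 * a 2) * darbouxPoint x₁ x₂ 0 * darbouxPoint x₁ x₂ 2
        - 4 * a 1 * darbouxPoint x₁ x₂ 1 * darbouxPoint x₁ x₂ 2) := by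
  have h : coeffK a x₁ x₂ = pointEq a ((1 : ℂ) : OnePoint ℂ) (darbouxPoint x₁ x₂) -
      coeffL a x₁ x₂ - pointEq a ((0 : ℂ) : OnePoint ℂ) (darbouxPoint x₁ x₂) := rfl
  rw [h, pointEq_some, pointEq_some, coeffL_eq]
  simp [darbouxPoint]
  ring

theorem coeffK_self (a : Fin 6 → ℂ) (x : OnePoint ℂ) : coeffK a x x = -quartic a x := by
  rw [coeffK_eq, quartic]
  simp [darbouxPoint]
  ring

theorem darbouxPoint_comm (x₁ x₂ : OnePoint ℂ) : darbouxPoint x₁ x₂ = darbouxPoint x₂ x₁ := by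
  ext i
  fin_cases i <;> simp [darbouxPoint] <;> ring

theorem hom_det_eq_zero_iff (x₁ x₂ : OnePoint ℂ) :
    (hom x₁).1 * (hom x₂).2 - (hom x₁).2 * (hom x₂).1 = 0 ↔ x₁ = x₂ := by
  induction x₁ using OnePoint.rec <;> induction x₂ using OnePoint.rec <;> simp [sub_eq_zero]

/-- A nonzero linear form has exactly one zero on the projective line. -/
theorem exists_linear_zero (α β : ℂ) (h : α ≠ 0 ∨ β ≠ 0) :
    ∃ x₀ : OnePoint ℂ, ∀ x, α * (hom x).1 + β * (hom x).2 = 0 ↔ x = x₀ := by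
  by_cases hα : α = 0
  · have hβ : β ≠ 0 := by tauto
    refine ⟨OnePoint.infty, fun x => ?_⟩
    rw [← hom_det_eq_zero_iff]
    simp [hα, hβ]
  · refine ⟨((-β / α : ℂ) : OnePoint ℂ), fun x => ?_⟩
    rw [← hom_det_eq_zero_iff]
    simp only [hom_coe]
    field_simp
    rw [sub_neg_eq_add]
    constructor <;> intro h <;> linear_combination h

/-- A nonzero quadratic form has at most two zeros on the projective line. -/
theorem exists_quadratic_zeros (α β γ : ℂ) (h : α ≠ 0 ∨ β ≠ 0 ∨ γ ≠ 0) :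
    ∃ x₁ x₂ : OnePoint ℂ, ∀ x,
      α * (hom x).1 ^ 2 + β * (hom x).1 * (hom x).2 + γ * (hom x).2 ^ 2 = 0 → x = x₁ ∨ x = x₂ := by
  by_cases hα : α = 0
  · subst hα
    obtain ⟨x₀, hx₀⟩ := exists_linear_zero β γ (by tauto)
    obtain ⟨x₁, hx₁⟩ := exists_linear_zero 0 1 (by simp)
    refine ⟨x₀, x₁, fun x hx => ?_⟩
    have : (β * (hom x).1 + γ * (hom x).2) * (0 * (hom x).1 + 1 * (hom x).2) = 0 := by
      linear_combination hx
    rcases mul_eq_zero.1 this with h | h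
    · exact Or.inl ((hx₀ x).1 h)
    · exact Or.inr ((hx₁ x).1 h)
  · obtain ⟨d, hd⟩ := IsAlgClosed.exists_pow_nat_eq (β ^ 2 - 4 * α * γ) two_pos
    obtain ⟨x₀, hx₀⟩ := exists_linear_zero (2 * α) (β - d) (by simp [hα])
    obtain ⟨x₁, hx₁⟩ := exists_linear_zero (2 * α) (β + d) (by simp [hα])
    refine ⟨x₀, x₁, fun x hx => ?_⟩
    have : (2 * α * (hom x).1 + (β - d) * (hom x).2) * (2 * α * (hom x).1 + (β + d) * (hom x).2)
        = 0 := by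
      linear_combination 4 * α * hx - (hom x).2 ^ 2 * hd
    rcases mul_eq_zero.1 this with h | h
    · exact Or.inl ((hx₀ x).1 h)
    · exact Or.inr ((hx₁ x).1 h)

/-! ## The birational change of coordinates at a finite branch point `e` -/

/-- Minus one half of `P'(e)`. -/
def halfDeriv (a : Fin 6 → ℂ) (e : ℂ) : ℂ :=
  -(2 * a 0 * e ^ 3 - 6 * a 1 * e ^ 2 + (2 * a 5 + 4 * a 2) * e - 2 * a 3)

/-- The leading coefficient of `K(e, x)`. -/
def leadCoeff (a : Fin 6 → ℂ) (e : ℂ) : ℂ := -(a 5 + a 0 * e ^ 2 - 2 * a 1 * e)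

/-- The form `p - eq` vanishing at `x = e`. -/
def denom (e : ℂ) (x : OnePoint ℂ) : ℂ := (hom x).1 - e * (hom x).2

/-- The linear form `K(e, x) / (x - e)`. -/
def numer (a : Fin 6 → ℂ) (e : ℂ) (x : OnePoint ℂ) : ℂ :=
  leadCoeff a e * (hom x).1 + (halfDeriv a e - e * leadCoeff a e) * (hom x).2

/-- The Weierstrass coordinate `X = -s` of the conic through `e ∩ x`. -/
noncomputable def abscissa (a : Fin 6 → ℂ) (e : ℂ) (x : OnePoint ℂ) : ℂ :=
  numer a e x / (2 * denom e x)

/-- The Weierstrass coordinate `Y` of a point of `Γ₁`. -/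
noncomputable def ordinate (a : Fin 6 → ℂ) (e : ℂ) (x : OnePoint ℂ) (y : ℂ) : ℂ :=
  Complex.I * halfDeriv a e * y / (4 * denom e x ^ 2)

theorem denom_eq_zero_iff (e : ℂ) (x : OnePoint ℂ) : denom e x = 0 ↔ x = (e : OnePoint ℂ) := by
  rw [← hom_det_eq_zero_iff, denom]
  simp only [hom_coe]
  constructor <;> intro h <;> linear_combination h

section

variable {a : Fin 6 → ℂ} {e : ℂ}

theorem coeff_four_eq (he : quartic a (e : OnePoint ℂ) = 0) :
    a 4 = -(a 0 * e ^ 4 - 4 * a 1 * e ^ 3 + (2 * a 5 + 4 * a 2) * e ^ 2 - 4 * a 3 * e) := by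
  simp only [quartic, hom_coe] at he
  linear_combination he

theorem pointEq_base (he : quartic a (e : OnePoint ℂ) = 0) (s : ℂ) (x : OnePoint ℂ) :
    4 * pointEq a (s : OnePoint ℂ) (darbouxPoint (e : OnePoint ℂ) x) =
      (2 * denom e x * s + numer a e x) ^ 2 := by
  rw [pointEq_some, coeff_four_eq he]
  simp only [darbouxPoint, denom, numer, leadCoeff, halfDeriv, Matrix.cons_val_zero,
    Matrix.cons_val_one, Matrix.cons_val]
  simp only [hom_coe]
  ring

theorem deriv_base (he : quartic a (e : OnePoint ℂ) = 0) (s : ℂ) (x : OnePoint ℂ) :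
    2 * coeffL a (e : OnePoint ℂ) x * s + coeffK a (e : OnePoint ℂ) x =
      denom e x * (2 * denom e x * s + numer a e x) := by
  rw [coeffK_eq, coeffL_eq, coeff_four_eq he]
  simp only [darbouxPoint, denom, numer, leadCoeff, halfDeriv, Matrix.cons_val_zero,
    Matrix.cons_val_one, Matrix.cons_val]
  simp only [hom_coe]
  ring

theorem numer_cubic (he : quartic a (e : OnePoint ℂ) = 0) (x : OnePoint ℂ) :
    2 * denom e x * numer a e x ^ 3
        + 4 * (gamma2Curve a).a₂ * denom e x ^ 2 * numer a e x ^ 2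
        + 8 * (gamma2Curve a).a₄ * denom e x ^ 3 * numer a e x
        + 16 * (gamma2Curve a).a₆ * denom e x ^ 4 = -halfDeriv a e ^ 2 * quartic a x := by
  simp only [gamma2Curve, quartic]
  rw [coeff_four_eq he]
  simp only [denom, numer, leadCoeff, halfDeriv]
  ring

theorem ordinate_sq (he : quartic a (e : OnePoint ℂ) = 0)
    {x : OnePoint ℂ} (hx : x ≠ (e : OnePoint ℂ)) {y : ℂ}
    (hy : y ^ 2 = quartic a x) :
    ordinate a e x y ^ 2 = abscissa a e x ^ 3 + (gamma2Curve a).a₂ * abscissa a e x ^ 2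
      + (gamma2Curve a).a₄ * abscissa a e x + (gamma2Curve a).a₆ := by
  have hu : denom e x ≠ 0 := fun h => hx ((denom_eq_zero_iff e x).1 h)
  have key := numer_cubic he x
  rw [← hy] at key
  have hI : Complex.I ^ 2 = -1 := Complex.I_sq
  rw [ordinate, abscissa]
  field_simp
  rw [hI]
  linear_combination -8 * key

theorem quartic_four_eq (he : quartic a (e : OnePoint ℂ) = 0)
    {x : OnePoint ℂ} (hx : x ≠ (e : OnePoint ℂ)) :
    -halfDeriv a e ^ 2 * quartic a x = 16 * denom e x ^ 4 * (abscissa a e x ^ 3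
      + (gamma2Curve a).a₂ * abscissa a e x ^ 2
      + (gamma2Curve a).a₄ * abscissa a e x + (gamma2Curve a).a₆) := by
  have hu : denom e x ≠ 0 := fun h => hx ((denom_eq_zero_iff e x).1 h)
  rw [← numer_cubic he x, abscissa]
  field_simp
  ring

theorem pointEq_abscissa (he : quartic a (e : OnePoint ℂ) = 0) (s : ℂ) {x₁ x₂ : OnePoint ℂ}
    (h₁ : x₁ ≠ (e : OnePoint ℂ)) (h₂ : x₂ ≠ (e : OnePoint ℂ)) :
    halfDeriv a e ^ 2 * pointEq a (s : OnePoint ℂ) (darbouxPoint x₁ x₂) =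
      4 * denom e x₁ ^ 2 * denom e x₂ ^ 2 *
        (gamma2Curve a).toAffine.triquadratic (-s) (abscissa a e x₁) (abscissa a e x₂) := by
  have hu₁ : denom e x₁ ≠ 0 := fun h => h₁ ((denom_eq_zero_iff e x₁).1 h)
  have hu₂ : denom e x₂ ≠ 0 := fun h => h₂ ((denom_eq_zero_iff e x₂).1 h)
  rw [pointEq_some, triquadratic, abscissa, abscissa]
  field_simp
  simp only [gamma2Curve]
  rw [coeff_four_eq he]
  simp only [darbouxPoint, denom, numer, leadCoeff, halfDeriv, Matrix.cons_val_zero,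
    Matrix.cons_val_one, Matrix.cons_val]
  ring

theorem deriv_abscissa (he : quartic a (e : OnePoint ℂ) = 0) (s : ℂ) {x₁ x₂ : OnePoint ℂ}
    (h₁ : x₁ ≠ (e : OnePoint ℂ)) (h₂ : x₂ ≠ (e : OnePoint ℂ)) :
    halfDeriv a e ^ 2 * (2 * coeffL a x₁ x₂ * s + coeffK a x₁ x₂) =
      -4 * denom e x₁ ^ 2 * denom e x₂ ^ 2 *
        (gamma2Curve a).toAffine.triquadraticDeriv (-s) (abscissa a e x₁) (abscissa a e x₂) := by
  have hu₁ : denom e x₁ ≠ 0 := fun h => h₁ ((denom_eq_zero_iff e x₁).1 h)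
  have hu₂ : denom e x₂ ≠ 0 := fun h => h₂ ((denom_eq_zero_iff e x₂).1 h)
  rw [coeffL_eq, coeffK_eq, triquadraticDeriv, abscissa, abscissa]
  field_simp
  simp only [gamma2Curve]
  rw [coeff_four_eq he]
  simp only [darbouxPoint, denom, numer, leadCoeff, halfDeriv, Matrix.cons_val_zero,
    Matrix.cons_val_one, Matrix.cons_val]
  ring

theorem ordinate_mul (x₁ x₂ : OnePoint ℂ) (y₁ y₂ : ℂ)
    (h₁ : x₁ ≠ (e : OnePoint ℂ)) (h₂ : x₂ ≠ (e : OnePoint ℂ)) :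
    16 * denom e x₁ ^ 2 * denom e x₂ ^ 2 * (ordinate a e x₁ y₁ * ordinate a e x₂ y₂) =
      -halfDeriv a e ^ 2 * (y₁ * y₂) := by
  have hu₁ : denom e x₁ ≠ 0 := fun h => h₁ ((denom_eq_zero_iff e x₁).1 h)
  have hu₂ : denom e x₂ ≠ 0 := fun h => h₂ ((denom_eq_zero_iff e x₂).1 h)
  have hI : Complex.I ^ 2 = -1 := Complex.I_sq
  rw [ordinate, ordinate]
  field_simp
  rw [hI]
  ring

theorem exists_abscissa_eq (hD : halfDeriv a e ≠ 0) (X : ℂ) :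
    ∃ x₀ : OnePoint ℂ, x₀ ≠ (e : OnePoint ℂ) ∧
      ∀ x, x ≠ (e : OnePoint ℂ) → (abscissa a e x = X ↔ x = x₀) := by
  obtain ⟨x₀, hx₀⟩ := exists_linear_zero (leadCoeff a e - 2 * X)
    (halfDeriv a e - e * leadCoeff a e + 2 * e * X) (by
      by_contra! h
      exact hD (by linear_combination h.2 + e * h.1))
  refine ⟨x₀, ?_, fun x hx => ?_⟩
  · rintro rfl
    have := (hx₀ (e : OnePoint ℂ)).2 rfl
    simp only [hom_coe] at this
    exact hD (by linear_combination this)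
  · have hu : denom e x ≠ 0 := fun h => hx ((denom_eq_zero_iff e x).1 h)
    rw [← hx₀, abscissa, div_eq_iff (by simpa using hu), numer, denom]
    constructor <;> intro h <;> linear_combination h

end

/-! ## The isomorphism of `Γ₁` with `Γ₂` defined by a branch point -/

/-- A finite simple branch point `e` of `Γ₁`, together with the smoothness of `Γ₂`. -/
structure BranchPoint (a : Fin 6 → ℂ) where
  e : ℂ
  quartic_eq_zero : quartic a (e : OnePoint ℂ) = 0
  halfDeriv_ne_zero : halfDeriv a e ≠ 0
  smooth : ∀ X : ℂ,
    X ^ 3 + (gamma2Curve a).a₂ * X ^ 2 + (gamma2Curve a).a₄ * X + (gamma2Curve a).a₆ = 0 →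
      3 * X ^ 2 + 2 * (gamma2Curve a).a₂ * X + (gamma2Curve a).a₄ ≠ 0

theorem generalPosition_iff (a : Fin 6 → ℂ) :
    GeneralPosition a ↔ {l : OnePoint ℂ | quartic a l = 0}.ncard = 4 := by
  simp only [GeneralPosition, isCommonTangent_iff]

theorem ncard_le_of_subset {α : Type*} {S : Set α} (l : List α) (h : ∀ x ∈ S, x ∈ l) :
    S.ncard ≤ l.length := by
  classical
  have h' : S ⊆ (l.toFinset : Set α) := fun x hx => by simpa using h x hx
  refine (Set.ncard_le_ncard h' (Finset.finite_toSet _)).trans ?_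
  rw [Set.ncard_coe_finset]
  exact l.toFinset_card_le

theorem GeneralPosition.exists_root {a : Fin 6 → ℂ} (ha : GeneralPosition a) :
    ∃ e : ℂ, quartic a (e : OnePoint ℂ) = 0 := by
  rw [generalPosition_iff] at ha
  by_contra! h
  have := ncard_le_of_subset (S := {l : OnePoint ℂ | quartic a l = 0}) [OnePoint.infty] (by
    intro x hx
    induction x using OnePoint.rec with
    | infty => simp
    | coe x => exact absurd hx (h x))
  simp only [List.length_singleton] at this
  omega

theorem GeneralPosition.halfDeriv_ne_zero {a : Fin 6 → ℂ} (ha : GeneralPosition a) {e : ℂ}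
    (he : quartic a (e : OnePoint ℂ) = 0) : halfDeriv a e ≠ 0 := by
  intro hD
  rw [generalPosition_iff] at ha
  set α := a 0
  set β := 2 * e * a 0 - 4 * a 1
  set γ := 3 * e ^ 2 * a 0 - 8 * e * a 1 + 2 * a 5 + 4 * a 2
  have fac : ∀ x, quartic a x = denom e x ^ 2 *
      (α * (hom x).1 ^ 2 + β * (hom x).1 * (hom x).2 + γ * (hom x).2 ^ 2) := by
    intro x
    rw [halfDeriv] at hD
    rw [quartic, coeff_four_eq he, denom]
    simp only [α, β, γ]
    linear_combination (2 * (hom x).1 * (hom x).2 ^ 3 - 2 * e * (hom x).2 ^ 4) * -hD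
  by_cases h0 : α ≠ 0 ∨ β ≠ 0 ∨ γ ≠ 0
  · obtain ⟨x₁, x₂, hx⟩ := exists_quadratic_zeros α β γ h0
    have := ncard_le_of_subset (S := {l : OnePoint ℂ | quartic a l = 0})
      [(e : OnePoint ℂ), x₁, x₂] (by
        intro x (h : quartic a x = 0)
        rw [fac, mul_eq_zero, pow_eq_zero_iff two_ne_zero, denom_eq_zero_iff] at h
        have := hx x
        simp only [List.mem_cons, List.not_mem_nil, or_false]
        tauto)
    simp only [List.length_cons, List.length_nil] at this
    omega
  · push Not at h0
    obtain ⟨h1, h2, h3⟩ := h0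
    have huniv : {l : OnePoint ℂ | quartic a l = 0} = Set.univ := by
      ext x
      simp [fac, h1, h2, h3]
    rw [huniv, Set.Infinite.ncard] at ha
    · omega
    · have : Infinite (OnePoint ℂ) := Infinite.of_injective _ OnePoint.coe_injective
      exact Set.infinite_univ

theorem GeneralPosition.nonempty_branchPoint {a : Fin 6 → ℂ} (ha : GeneralPosition a) :
    Nonempty (BranchPoint a) := by
  obtain ⟨e, he⟩ := ha.exists_root
  have hD := ha.halfDeriv_ne_zero he
  refine ⟨⟨e, he, hD, fun X hX hX' => ?_⟩⟩
  rw [generalPosition_iff] at ha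
  obtain ⟨x₀, -, hx₀⟩ := exists_abscissa_eq hD X
  obtain ⟨x₁, -, hx₁⟩ := exists_abscissa_eq hD (-(gamma2Curve a).a₂ - 2 * X)
  have := ncard_le_of_subset (S := {l : OnePoint ℂ | quartic a l = 0})
    [(e : OnePoint ℂ), x₀, x₁] (by
      intro x (h : quartic a x = 0)
      by_cases hx : x = e
      · simp [hx]
      have hu : denom e x ≠ 0 := fun h => hx ((denom_eq_zero_iff e x).1 h)
      have h4 := quartic_four_eq he hx
      rw [h, mul_zero, eq_comm, mul_eq_zero_iff_left (by simpa using hu)] at h4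
      have : (abscissa a e x - X) ^ 2 * (abscissa a e x - (-(gamma2Curve a).a₂ - 2 * X)) = 0 := by
        linear_combination h4 - hX - (abscissa a e x - X) * hX'
      rw [mul_eq_zero, pow_eq_zero_iff two_ne_zero, sub_eq_zero, sub_eq_zero, hx₀ x hx,
        hx₁ x hx] at this
      simp only [List.mem_cons, List.not_mem_nil, or_false]
      tauto)
  simp only [List.length_cons, List.length_nil] at this
  omega

theorem gamma2Curve_a₁ (a : Fin 6 → ℂ) : (gamma2Curve a).a₁ = 0 := rfl

theorem gamma2Curve_a₃ (a : Fin 6 → ℂ) : (gamma2Curve a).a₃ = 0 := rfl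

namespace BranchPoint

variable {a : Fin 6 → ℂ}

theorem nonsingular_iff (B : BranchPoint a) (X Y : ℂ) : (gamma2Curve a).toAffine.Nonsingular X Y ↔
    Y ^ 2 = X ^ 3 + (gamma2Curve a).a₂ * X ^ 2 + (gamma2Curve a).a₄ * X + (gamma2Curve a).a₆ := by
  rw [nonsingular_short_iff (gamma2Curve_a₁ a) (gamma2Curve_a₃ a)]
  refine ⟨fun h => h.1, fun h => ⟨h, ?_⟩⟩
  rintro rfl
  exact B.smooth X (by rw [← h]; simp)

/-- Every conic of the pencil is the conic of an element of the coset group. -/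
theorem exists_pencilParam_eq (B : BranchPoint a) (s : OnePoint ℂ) :
    ∃ P : CosetGroup a, pencilParam a P = s := by
  induction s using OnePoint.rec with
  | infty => exact ⟨CosetSpace.mk 0, rfl⟩
  | coe s =>
    obtain ⟨Y, hY⟩ := IsAlgClosed.exists_pow_nat_eq ((-s) ^ 3 + (gamma2Curve a).a₂ * (-s) ^ 2
      + (gamma2Curve a).a₄ * -s + (gamma2Curve a).a₆) two_pos
    refine ⟨CosetSpace.mk (Point.some _ _ ((B.nonsingular_iff _ _).2 hY)), ?_⟩
    show ((- -s : ℂ) : OnePoint ℂ) = s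
    rw [neg_neg]

variable (B : BranchPoint a)

theorem nonsingular {M : Gamma1 a} (h : M.x ≠ B.e) :
    (gamma2Curve a).toAffine.Nonsingular (abscissa a B.e M.x) (ordinate a B.e M.x M.y) :=
  (B.nonsingular_iff _ _).2 (ordinate_sq B.quartic_eq_zero h M.eq)

open Classical in
/-- The isomorphism of `Γ₁` with `Γ₂` which maps the branch point to zero. -/
noncomputable def toGamma2 (M : Gamma1 a) : Gamma2 a :=
  if h : M.x = B.e then 0 else .some _ _ (B.nonsingular h)

theorem toGamma2_of_eq {M : Gamma1 a} (h : M.x = B.e) : B.toGamma2 M = 0 := dif_pos h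

theorem toGamma2_of_ne {M : Gamma1 a} (h : M.x ≠ B.e) :
    B.toGamma2 M = .some _ _ (B.nonsingular h) := dif_neg h

theorem toGamma2_eq_zero_iff {M : Gamma1 a} : B.toGamma2 M = 0 ↔ M.x = B.e := by
  refine ⟨fun h => ?_, B.toGamma2_of_eq⟩
  by_contra hx
  rw [B.toGamma2_of_ne hx] at h
  exact Point.some_ne_zero _ h

theorem y_eq_zero {M : Gamma1 a} (h : M.x = B.e) : M.y = 0 := by
  have := M.eq
  rwa [h, B.quartic_eq_zero, pow_eq_zero_iff two_ne_zero] at this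

theorem denom_ne_zero {x : OnePoint ℂ} (h : x ≠ B.e) : denom B.e x ≠ 0 :=
  fun h' => h ((denom_eq_zero_iff B.e x).1 h')

theorem abscissa_inj {x₁ x₂ : OnePoint ℂ} (h₁ : x₁ ≠ B.e) (h₂ : x₂ ≠ B.e)
    (h : abscissa a B.e x₁ = abscissa a B.e x₂) : x₁ = x₂ := by
  obtain ⟨x₀, -, h₀⟩ := exists_abscissa_eq B.halfDeriv_ne_zero (abscissa a B.e x₂)
  rw [(h₀ x₁ h₁).1 h, ← (h₀ x₂ h₂).1 rfl]

theorem ordinate_eq_iff {x : OnePoint ℂ} (h : x ≠ B.e) (y : ℂ) (Y : ℂ) :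
    ordinate a B.e x y = Y ↔ y = 4 * denom B.e x ^ 2 * Y / (Complex.I * halfDeriv a B.e) := by
  have := B.denom_ne_zero h
  have hD := B.halfDeriv_ne_zero
  have hI := Complex.I_ne_zero
  rw [ordinate]
  field_simp

theorem toGamma2_bijective : Function.Bijective B.toGamma2 := by
  constructor
  · intro M N h
    by_cases hM : M.x = B.e
    · have hN : N.x = B.e := by
        rw [← B.toGamma2_eq_zero_iff, ← h, B.toGamma2_eq_zero_iff, hM]
      exact Gamma1.ext (hM.trans hN.symm) ((B.y_eq_zero hM).trans (B.y_eq_zero hN).symm)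
    · have hN : N.x ≠ B.e := by
        rwa [Ne, ← B.toGamma2_eq_zero_iff, ← h, B.toGamma2_eq_zero_iff]
      rw [B.toGamma2_of_ne hM, B.toGamma2_of_ne hN, Point.some.injEq] at h
      have hx := B.abscissa_inj hM hN h.1
      refine Gamma1.ext hx ?_
      have h2 := h.2
      rw [hx] at h2
      exact ((B.ordinate_eq_iff hN _ _).1 h2).trans ((B.ordinate_eq_iff hN _ _).1 rfl).symm
  · rintro (_ | ⟨X, Y, n⟩)
    · exact ⟨⟨B.e, 0, by rw [B.quartic_eq_zero]; simp⟩, B.toGamma2_of_eq rfl⟩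
    · obtain ⟨x₀, hne, h₀⟩ := exists_abscissa_eq B.halfDeriv_ne_zero X
      have hX : abscissa a B.e x₀ = X := (h₀ x₀ hne).2 rfl
      obtain ⟨y, hy⟩ : ∃ y, ordinate a B.e x₀ y = Y := ⟨_, (B.ordinate_eq_iff hne _ _).2 rfl⟩
      have hu := B.denom_ne_zero hne
      have heq : y ^ 2 = quartic a x₀ := by
        have h1 := quartic_four_eq B.quartic_eq_zero hne
        rw [hX, ← (B.nonsingular_iff X Y).1 n] at h1
        have h2 := ordinate_mul (a := a) x₀ x₀ y y hne hne
        rw [hy] at h2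
        have hD : halfDeriv a B.e ^ 2 ≠ 0 := pow_ne_zero 2 B.halfDeriv_ne_zero
        refine mul_left_cancel₀ hD ?_
        linear_combination h1 + h2
      refine ⟨⟨x₀, y, heq⟩, ?_⟩
      rw [B.toGamma2_of_ne hne, Point.some.injEq]
      exact ⟨hX, hy⟩

end BranchPoint

section

variable {a : Fin 6 → ℂ}

theorem isValue_zero_iff (M N : Gamma1 a) : IsValue a (CosetSpace.mk 0) M N ↔ N = M := by
  show coeffL a M.x N.x = 0 ∧ -coeffK a M.x N.x = M.y * N.y ↔ N = M
  rw [coeffL_eq, pow_eq_zero_iff two_ne_zero, hom_det_eq_zero_iff]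
  constructor
  · rintro ⟨hx, hK⟩
    rw [← hx, coeffK_self, neg_neg, ← M.eq] at hK
    refine Gamma1.ext hx.symm ?_
    have hN := N.eq
    rw [← hx, ← M.eq] at hN
    have : (N.y - M.y) ^ 2 = 0 := by linear_combination hN + 2 * hK
    rwa [pow_eq_zero_iff two_ne_zero, sub_eq_zero] at this
  · rintro rfl
    refine ⟨rfl, ?_⟩
    rw [coeffK_self, neg_neg, ← N.eq]
    ring

theorem isValue_some_iff {X Y : ℂ} (n : (gamma2Curve a).toAffine.Nonsingular X Y)
    (M N : Gamma1 a) : IsValue a (CosetSpace.mk (Point.some X Y n)) M N ↔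
      pointEq a ((-X : ℂ) : OnePoint ℂ) (darbouxPoint M.x N.x) = 0 ∧
        2 * coeffL a M.x N.x * -X + coeffK a M.x N.x = M.y * N.y := Iff.rfl

theorem isValue_comm (P : CosetGroup a) (M N : Gamma1 a) :
    IsValue a P M N ↔ IsValue a P N M := by
  have hK : coeffK a M.x N.x = coeffK a N.x M.x := by
    rw [coeffK_eq, coeffK_eq, darbouxPoint_comm]
  have hL : coeffL a M.x N.x = coeffL a N.x M.x := by
    rw [coeffL, coeffL, darbouxPoint_comm]
  rw [IsValue, IsValue, darbouxPoint_comm]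
  generalize pencilParam a P = s
  rcases s with _ | s
  · simp only [BranchCondition, hK, mul_comm M.y]
  · simp only [BranchCondition, hK, hL, mul_comm M.y]

theorem exists_over (x : OnePoint ℂ) : ∃ M : Gamma1 a, M.x = x := by
  obtain ⟨y, hy⟩ := IsAlgClosed.exists_pow_nat_eq (quartic a x) two_pos
  exact ⟨⟨x, y, hy⟩, rfl⟩

/-- The derivative of the pencil equation with respect to its parameter. -/
noncomputable def pencilDeriv (a : Fin 6 → ℂ) (x₁ x₂ : OnePoint ℂ) : OnePoint ℂ → ℂ
  | none => -coeffK a x₁ x₂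
  | some s => 2 * coeffL a x₁ x₂ * s + coeffK a x₁ x₂

theorem isValue_iff_pencilDeriv (P : CosetGroup a) (M N : Gamma1 a) : IsValue a P M N ↔
    OnConic a (pencilParam a P) (darbouxPoint M.x N.x) ∧
      pencilDeriv a M.x N.x (pencilParam a P) = M.y * N.y := by
  rw [IsValue]
  generalize pencilParam a P = s
  rcases s with _ | s <;> rfl

theorem pencilDeriv_sq {s x₁ x₂ : OnePoint ℂ} (h : OnConic a s (darbouxPoint x₁ x₂)) :
    pencilDeriv a x₁ x₂ s ^ 2 = quartic a x₁ * quartic a x₂ := by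
  rw [← discrim_eq]
  induction s using OnePoint.rec with
  | infty =>
    have hL : coeffL a x₁ x₂ = 0 := h
    have : pencilDeriv a x₁ x₂ OnePoint.infty = -coeffK a x₁ x₂ := rfl
    rw [this, hL]
    ring
  | coe s =>
    have hF := (pointEq_eq a s x₁ x₂).symm.trans h
    have : pencilDeriv a x₁ x₂ (s : OnePoint ℂ) = 2 * coeffL a x₁ x₂ * s + coeffK a x₁ x₂ := rfl
    rw [this]
    linear_combination 4 * coeffL a x₁ x₂ * hF

/-- Tangents meeting on a conic of the pencil can be lifted to points of `Γ₁`. -/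
theorem exists_isValue (P : CosetGroup a) (M : Gamma1 a) {x : OnePoint ℂ}
    (h : OnConic a (pencilParam a P) (darbouxPoint M.x x)) : ∃ N : Gamma1 a, N.x = x ∧
      IsValue a P M N := by
  have hsq := pencilDeriv_sq h
  rw [← M.eq] at hsq
  by_cases hy : M.y = 0
  · obtain ⟨N, rfl⟩ := exists_over (a := a) x
    refine ⟨N, rfl, (isValue_iff_pencilDeriv _ _ _).2 ⟨h, ?_⟩⟩
    rw [hy] at hsq ⊢
    simpa using hsq
  · refine ⟨⟨x, pencilDeriv a M.x x (pencilParam a P) / M.y, ?_⟩, rfl,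
      (isValue_iff_pencilDeriv _ _ _).2 ⟨h, ?_⟩⟩
    · rw [div_pow, hsq]
      field_simp
    · show pencilDeriv a M.x x (pencilParam a P) =
        M.y * (pencilDeriv a M.x x (pencilParam a P) / M.y)
      field_simp

end

namespace BranchPoint

variable {a : Fin 6 → ℂ} (B : BranchPoint a)

theorem isValue_base_iff {X Y : ℂ} (n : (gamma2Curve a).toAffine.Nonsingular X Y)
    {M N : Gamma1 a} (hM : M.x = B.e) : IsValue a (CosetSpace.mk (Point.some X Y n)) M N ↔
      B.toGamma2 N = Point.some X Y n ∨ B.toGamma2 N = -Point.some X Y n := by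
  have hsq : pointEq a ((-X : ℂ) : OnePoint ℂ) (darbouxPoint M.x N.x) = 0 ↔
      2 * denom B.e N.x * -X + numer a B.e N.x = 0 := by
    have := pointEq_base B.quartic_eq_zero (-X) N.x
    rw [hM, ← pow_eq_zero_iff (a := 2 * denom B.e N.x * -X + numer a B.e N.x) two_ne_zero, ← this]
    simp
  have hder := deriv_base B.quartic_eq_zero (-X) N.x
  rw [isValue_some_iff, hsq, B.y_eq_zero hM, hM, hder, zero_mul]
  rw [and_iff_left_of_imp (by intro h; rw [h, mul_zero])]
  by_cases hN : N.x = B.e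
  · rw [B.toGamma2_of_eq hN, hN]
    constructor
    · intro h
      simp only [denom, numer, hom_coe] at h
      exact absurd (by linear_combination h) B.halfDeriv_ne_zero
    · rintro (h | h)
      · exact absurd h.symm (Point.some_ne_zero n)
      · exact absurd (neg_eq_zero.1 h.symm) (Point.some_ne_zero n)
  · rw [B.toGamma2_of_ne hN, ← Point.X_eq_iff, abscissa,
      div_eq_iff (by simpa using B.denom_ne_zero hN)]
    constructor <;> intro h <;> linear_combination h

/-- The pencil equation with the branch condition is translation by `±g`. -/
theorem isValue_iff (g : Gamma2 a) (M N : Gamma1 a) : IsValue a (CosetSpace.mk g) M N ↔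
    B.toGamma2 N = B.toGamma2 M + g ∨ B.toGamma2 N = B.toGamma2 M - g := by
  by_cases hg : g = 0
  · subst hg
    rw [isValue_zero_iff, add_zero, sub_zero, or_self, B.toGamma2_bijective.1.eq_iff]
  rcases g with _ | ⟨X, Y, n⟩
  · exact absurd rfl hg
  by_cases hM : M.x = B.e
  · rw [B.isValue_base_iff n hM, B.toGamma2_of_eq hM, zero_add, zero_sub]
  by_cases hN : N.x = B.e
  · rw [isValue_comm, B.isValue_base_iff n hN, B.toGamma2_of_eq hN, eq_comm (a := (0 : Gamma2 a)),
      eq_comm (a := (0 : Gamma2 a)), sub_eq_zero, add_eq_zero_iff_eq_neg, or_comm]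
  have hu := B.denom_ne_zero hM
  have hv := B.denom_ne_zero hN
  have hD := B.halfDeriv_ne_zero
  have h1 := pointEq_abscissa B.quartic_eq_zero (-X) hM hN
  have h2 := deriv_abscissa B.quartic_eq_zero (-X) hM hN
  have h3 := ordinate_mul (a := a) M.x N.x M.y N.y hM hN
  rw [neg_neg] at h1 h2
  rw [B.toGamma2_of_ne hM, B.toGamma2_of_ne hN,
    ← triquadratic_iff (gamma2Curve_a₁ a) (gamma2Curve_a₃ a) n, isValue_some_iff]
  refine and_congr ?_ ?_
  · rw [← mul_eq_zero_iff_left (pow_ne_zero 2 hD), h1, mul_eq_zero_iff_left (by simp [hu, hv])]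
  · rw [← mul_right_inj' (pow_ne_zero 2 hD), h2,
      ← mul_right_inj' (a := -4 * denom B.e M.x ^ 2 * denom B.e N.x ^ 2) (by simp [hu, hv])
        (b := triquadraticDeriv _ _ _ _)]
    constructor <;> intro h
    · linear_combination h + h3
    · linear_combination h - h3

theorem exists_values (g : Gamma2 a) (M : Gamma1 a) : ∃ N₁ N₂ : Gamma1 a,
    B.toGamma2 N₁ = B.toGamma2 M + g ∧ B.toGamma2 N₂ = B.toGamma2 M - g ∧
      pencilAction a (CosetSpace.mk g) M = pair N₁ N₂ := by
  obtain ⟨N₁, h₁⟩ := B.toGamma2_bijective.2 (B.toGamma2 M + g)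
  obtain ⟨N₂, h₂⟩ := B.toGamma2_bijective.2 (B.toGamma2 M - g)
  refine ⟨N₁, N₂, h₁, h₂, ?_⟩
  have hset : {K | IsValue a (CosetSpace.mk g) M K} = {N₁, N₂} := by
    ext K
    show IsValue a (CosetSpace.mk g) M K ↔ K = N₁ ∨ K = N₂
    rw [B.isValue_iff, ← h₁, ← h₂, B.toGamma2_bijective.1.eq_iff, B.toGamma2_bijective.1.eq_iff]
  have hex : ∃ N : Gamma1 a × Gamma1 a, {K | IsValue a (CosetSpace.mk g) M K} = {N.1, N.2} :=
    ⟨(N₁, N₂), hset⟩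
  rw [pencilAction, dif_pos hex]
  have hc := Set.pair_eq_pair_iff.1 (hset.symm.trans hex.choose_spec)
  rcases hc with ⟨e₁, e₂⟩ | ⟨e₁, e₂⟩
  · rw [← e₁, ← e₂]
  · rw [← e₁, ← e₂, pair_comm]

/-- The values of the pencil action in terms of the group law of `Γ₂`. -/
theorem map_pencilAction (g : Gamma2 a) (M : Gamma1 a) :
    (pencilAction a (CosetSpace.mk g) M : Multiset (Gamma1 a)).map B.toGamma2 =
      {B.toGamma2 M + g, B.toGamma2 M - g} := by
  obtain ⟨N₁, N₂, h₁, h₂, h⟩ := B.exists_values g M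
  rw [h, ← h₁, ← h₂]
  rfl

theorem map_bind_pencilAction (g h : Gamma2 a) (M : Gamma1 a) :
    ((pencilAction a (CosetSpace.mk g) M : Multiset (Gamma1 a)).bind
      fun N => (pencilAction a (CosetSpace.mk h) N : Multiset (Gamma1 a))).map B.toGamma2 =
      {B.toGamma2 M + g + h, B.toGamma2 M + g - h, B.toGamma2 M - g + h, B.toGamma2 M - g - h} := by
  rw [Multiset.map_bind]
  simp only [map_pencilAction]
  rw [← Multiset.bind_map (f := B.toGamma2) (n := fun m => ({m + h, m - h} : Multiset (Gamma2 a))),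
    map_pencilAction]
  simp only [Multiset.insert_eq_cons, Multiset.cons_bind, Multiset.singleton_bind,
    Multiset.cons_add, Multiset.singleton_add]

end BranchPoint

theorem cosetMul_mk {G : Type*} [AddCommGroup G] (g h : G) :
    (cosetMul (CosetSpace.mk g) (CosetSpace.mk h) : Multiset (CosetSpace G)) =
      {CosetSpace.mk (g + h), CosetSpace.mk (g - h)} := rfl

theorem coset_induction {G : Type*} [AddCommGroup G] {p : CosetSpace G → Prop}
    (h : ∀ g, p (CosetSpace.mk g)) (x : CosetSpace G) : p x := Quotient.ind h x

theorem mk_eq_mk_iff {G : Type*} [AddCommGroup G] (g h : G) :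
    CosetSpace.mk g = CosetSpace.mk h ↔ g = h ∨ g = -h :=
  Quotient.eq (r := signSetoid G)

/-- Two-valued coset groups are associative. -/
theorem associative_cosetMul (G : Type*) [AddCommGroup G] :
    Associative (cosetMul (G := G)) := by
  intro x y z
  induction x using coset_induction with | h x
  induction y using coset_induction with | h y
  induction z using coset_induction with | h z
  have e₁ : CosetSpace.mk (x - (y + z)) = CosetSpace.mk (x - y - z) := by rw [sub_sub]
  have e₂ : CosetSpace.mk (x - (y - z)) = CosetSpace.mk (x - y + z) := by
    rw [sub_sub_eq_add_sub, add_sub_right_comm]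
  simp only [cosetMul_mk, Multiset.insert_eq_cons, Multiset.cons_bind, Multiset.singleton_bind,
    Multiset.singleton_add, Multiset.cons_add, e₁, e₂, ← add_assoc, ← add_sub_assoc]
  simp only [← Multiset.singleton_add]
  abel

namespace BranchPoint

variable {a : Fin 6 → ℂ} (B : BranchPoint a)

theorem actionAssociative (B : BranchPoint a) :
    ActionAssociative (groupOp a) (pencilAction a) := by
  intro P Q M
  induction P using coset_induction with | h p
  induction Q using coset_induction with | h q
  refine Multiset.map_injective B.toGamma2_bijective.1 ?_
  rw [B.map_bind_pencilAction, groupOp, cosetMul_mk]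
  simp only [Multiset.insert_eq_cons, Multiset.cons_bind, Multiset.singleton_bind,
    Multiset.map_add, B.map_pencilAction]
  have e₁ : B.toGamma2 M + q + p = B.toGamma2 M + (p + q) := by abel
  have e₂ : B.toGamma2 M + q - p = B.toGamma2 M - (p - q) := by abel
  have e₃ : B.toGamma2 M - q + p = B.toGamma2 M + (p - q) := by abel
  have e₄ : B.toGamma2 M - q - p = B.toGamma2 M - (p + q) := by abel
  rw [e₁, e₂, e₃, e₄]
  simp only [← Multiset.singleton_add]
  abel

theorem toGamma2_eq_or_neg {M N : Gamma1 a} (h : M.x = N.x) :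
    B.toGamma2 M = B.toGamma2 N ∨ B.toGamma2 M = -B.toGamma2 N := by
  by_cases hM : M.x = B.e
  · rw [B.toGamma2_of_eq hM, B.toGamma2_of_eq (h ▸ hM)]
    exact Or.inl rfl
  · rw [B.toGamma2_of_ne hM, B.toGamma2_of_ne (h ▸ hM), ← Point.X_eq_iff, h]

theorem mem_groupOp_iff (p q r : Gamma2 a) :
    CosetSpace.mk r ∈ groupOp a (CosetSpace.mk q) (CosetSpace.mk p) ↔
      (r = q + p ∨ r = -(q + p)) ∨ (r = q - p ∨ r = -(q - p)) := by
  rw [← mk_eq_mk_iff, ← mk_eq_mk_iff, groupOp, ← Sym.mem_coe, cosetMul_mk]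
  simp

/-- A triple of conics corresponding to the group operation completes a chain of values. -/
theorem exists_isValue_chain (B : BranchPoint a) {P Q R : CosetGroup a}
    (h : R ∈ groupOp a Q P) {M N : Gamma1 a}
    (hN : IsValue a P M N) : ∃ K : Gamma1 a, IsValue a Q N K ∧ IsValue a R M K := by
  induction P using coset_induction with | h p
  induction Q using coset_induction with | h q
  induction R using coset_induction with | h r
  rw [mem_groupOp_iff] at h
  rw [B.isValue_iff] at hN
  have : ∃ k : Gamma2 a, (k = B.toGamma2 N + q ∨ k = B.toGamma2 N - q) ∧
      (k = B.toGamma2 M + r ∨ k = B.toGamma2 M - r) := by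
    rcases hN with hN | hN <;> rw [hN]
    · rcases h with h | h
      · refine ⟨_, Or.inl rfl, ?_⟩
        rcases h with rfl | rfl
        · left; abel
        · right; abel
      · refine ⟨_, Or.inr rfl, ?_⟩
        rcases h with rfl | rfl
        · right; abel
        · left; abel
    · rcases h with h | h
      · refine ⟨_, Or.inr rfl, ?_⟩
        rcases h with rfl | rfl
        · right; abel
        · left; abel
      · refine ⟨_, Or.inl rfl, ?_⟩
        rcases h with rfl | rfl
        · left; abel
        · right; abel
  obtain ⟨k, h₁, h₂⟩ := this
  obtain ⟨K, rfl⟩ := B.toGamma2_bijective.2 k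
  exact ⟨K, (B.isValue_iff _ _ _).2 h₁, (B.isValue_iff _ _ _).2 h₂⟩

theorem isPoristic_of_mem (B : BranchPoint a) {P Q R : CosetGroup a} (h : R ∈ groupOp a Q P) :
    IsPoristic a (pencilParam a P) (pencilParam a Q) (pencilParam a R) := by
  intro b₁ b₂ hb
  obtain ⟨M, rfl⟩ := exists_over (a := a) b₁
  obtain ⟨N, rfl, hN⟩ := exists_isValue P M hb
  obtain ⟨K, h₁, h₂⟩ := B.exists_isValue_chain h hN
  exact ⟨K.x, h₁.1, h₂.1⟩

theorem mem_groupOp_of_chain (B : BranchPoint a) {P Q R : CosetGroup a} {M N K : Gamma1 a}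
    (h₁ : IsValue a P M N) (h₂ : IsValue a Q N K) (h₃ : IsValue a R M K) :
    R ∈ groupOp a Q P := by
  induction P using coset_induction with | h p
  induction Q using coset_induction with | h q
  induction R using coset_induction with | h r
  rw [mem_groupOp_iff]
  rw [B.isValue_iff] at h₁ h₂ h₃
  have hr : r = B.toGamma2 K - B.toGamma2 M ∨ r = -(B.toGamma2 K - B.toGamma2 M) := by
    rcases h₃ with h₃ | h₃ <;> rw [h₃]
    · left; abel
    · right; abel
  have hk : ∃ c, (c = q + p ∨ c = q - p) ∧
      (B.toGamma2 K - B.toGamma2 M = c ∨ B.toGamma2 K - B.toGamma2 M = -c) := by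
    rcases h₁ with h₁ | h₁ <;> rcases h₂ with h₂ | h₂ <;> rw [h₂, h₁]
    · refine ⟨_, Or.inl rfl, Or.inl ?_⟩; abel
    · refine ⟨_, Or.inr rfl, Or.inr ?_⟩; abel
    · refine ⟨_, Or.inr rfl, Or.inl ?_⟩; abel
    · refine ⟨_, Or.inl rfl, Or.inr ?_⟩; abel
  obtain ⟨c, hc, hkc⟩ := hk
  have hrc : r = c ∨ r = -c := by
    rcases hr with hr | hr <;> rcases hkc with hkc | hkc <;> rw [hr, hkc] <;> simp
  rcases hc with rfl | rfl
  · exact Or.inl hrc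
  · exact Or.inr hrc

theorem infinite_gamma2 (B : BranchPoint a) : Infinite (Gamma2 a) := by
  refine (Set.infinite_univ_iff).1 fun h => ?_
  have : (Set.univ : Set (OnePoint ℂ)) ⊆
      (fun g : Gamma2 a => pencilParam a (CosetSpace.mk g)) '' Set.univ := by
    intro s _
    obtain ⟨P, hP⟩ := B.exists_pencilParam_eq s
    induction P using coset_induction with | h p
    exact ⟨p, trivial, hP⟩
  have : Infinite (OnePoint ℂ) := Infinite.of_injective _ OnePoint.coe_injective
  exact Set.infinite_univ ((h.image _).subset ‹_›)

end BranchPoint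

/-! ## Concurrence of the tangents at the vertices -/

/-- The determinant of the homogeneous coordinates of two points of `ℂℙ¹`. -/
def homDet (x₁ x₂ : OnePoint ℂ) : ℂ := (hom x₁).1 * (hom x₂).2 - (hom x₁).2 * (hom x₂).1

theorem homDet_ne_zero {x₁ x₂ : OnePoint ℂ} (h : x₁ ≠ x₂) : homDet x₁ x₂ ≠ 0 :=
  fun h' => h ((hom_det_eq_zero_iff x₁ x₂).1 h')

theorem homDet_swap (x₁ x₂ : OnePoint ℂ) : homDet x₂ x₁ = -homDet x₁ x₂ := by
  rw [homDet, homDet]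
  ring

theorem concurrent_iff (u v w : Fin 3 → ℂ) :
    Concurrent u v w ↔ (Matrix.of ![u, v, w]).det = 0 := by
  rw [← Matrix.exists_mulVec_eq_zero_iff, Concurrent]
  refine exists_congr fun z => and_congr_right fun _ => ?_
  rw [funext_iff, Fin.forall_fin_succ, Fin.forall_fin_succ, Fin.forall_fin_one]
  rfl

/-- Expansion of a line in terms of its values at the vertices of a triangle of tangents. -/
theorem triangle_expansion (x₁ x₂ x₃ : OnePoint ℂ) (t w : Fin 3 → ℂ) :
    homDet x₁ x₂ * homDet x₁ x₃ * homDet x₂ x₃ * (w ⬝ᵥ t) =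
      homDet x₂ x₃ * (t ⬝ᵥ darbouxPoint x₂ x₃) * (w ⬝ᵥ tangentLine x₁)
        - homDet x₁ x₃ * (t ⬝ᵥ darbouxPoint x₁ x₃) * (w ⬝ᵥ tangentLine x₂)
        + homDet x₁ x₂ * (t ⬝ᵥ darbouxPoint x₁ x₂) * (w ⬝ᵥ tangentLine x₃) := by
  simp only [homDet, darbouxPoint, tangentLine, dotProduct, Fin.sum_univ_three,
    Matrix.cons_val_zero, Matrix.cons_val_one, Matrix.cons_val]
  ring

theorem concurrent_iff_vertices {x₁ x₂ x₃ : OnePoint ℂ} (h₁₂ : x₁ ≠ x₂) (h₁₃ : x₁ ≠ x₃)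
    (h₂₃ : x₂ ≠ x₃) {t₁ t₂ t₃ : Fin 3 → ℂ} (h₁ : t₁ ⬝ᵥ darbouxPoint x₁ x₂ = 0)
    (h₂ : t₂ ⬝ᵥ darbouxPoint x₂ x₃ = 0) (h₃ : t₃ ⬝ᵥ darbouxPoint x₁ x₃ = 0) :
    Concurrent t₁ t₂ t₃ ↔
      (t₁ ⬝ᵥ darbouxPoint x₂ x₃) * (t₂ ⬝ᵥ darbouxPoint x₁ x₃) * (t₃ ⬝ᵥ darbouxPoint x₁ x₂)
        + (t₁ ⬝ᵥ darbouxPoint x₁ x₃) * (t₂ ⬝ᵥ darbouxPoint x₁ x₂) * (t₃ ⬝ᵥ darbouxPoint x₂ x₃)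
        = 0 := by
  rw [concurrent_iff]
  set Z : Matrix (Fin 3) (Fin 3) ℂ :=
    Matrix.of ![darbouxPoint x₁ x₂, darbouxPoint x₂ x₃, darbouxPoint x₁ x₃]
  have hZ : 2 * Z.det = homDet x₁ x₂ * homDet x₁ x₃ * homDet x₂ x₃ := by
    simp [Z, Matrix.det_fin_three, darbouxPoint, homDet]
    ring
  have hZ0 : Z.det ≠ 0 := by
    intro h
    rw [h, mul_zero, eq_comm] at hZ
    simp [homDet_ne_zero h₁₂, homDet_ne_zero h₁₃, homDet_ne_zero h₂₃] at hZ
  have hprod : Matrix.of ![t₁, t₂, t₃] * Z.transpose =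
      !![t₁ ⬝ᵥ darbouxPoint x₁ x₂, t₁ ⬝ᵥ darbouxPoint x₂ x₃, t₁ ⬝ᵥ darbouxPoint x₁ x₃;
        t₂ ⬝ᵥ darbouxPoint x₁ x₂, t₂ ⬝ᵥ darbouxPoint x₂ x₃, t₂ ⬝ᵥ darbouxPoint x₁ x₃;
        t₃ ⬝ᵥ darbouxPoint x₁ x₂, t₃ ⬝ᵥ darbouxPoint x₂ x₃, t₃ ⬝ᵥ darbouxPoint x₁ x₃] := by
    ext i j
    fin_cases i <;> fin_cases j <;> rfl
  have hdet := congrArg Matrix.det hprod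
  rw [Matrix.det_mul, Matrix.det_transpose, h₁, h₂, h₃] at hdet
  rw [← mul_eq_zero_iff_right hZ0, hdet, Matrix.det_fin_three]
  simp only [Matrix.of_apply, Matrix.cons_val_zero, Matrix.cons_val_one, Matrix.cons_val,
    Matrix.cons_val']
  constructor <;> intro h <;> linear_combination h

theorem tangentialMatrix_isSymm (a : Fin 6 → ℂ) (s : ℂ) :
    (tangentialMatrix a (s : OnePoint ℂ)).IsSymm := by
  ext i j
  fin_cases i <;> fin_cases j <;> rfl

theorem tangentialMatrix_tangentLine_self (a : Fin 6 → ℂ) (s : ℂ) (x : OnePoint ℂ) :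
    (tangentialMatrix a (s : OnePoint ℂ)).mulVec (tangentLine x) ⬝ᵥ tangentLine x
      = quartic a x := by
  have h : tangentialMatrix a (s : OnePoint ℂ) =
      !![a 0, a 1, a 5 - 2 * s; a 1, a 2 + s, a 3; a 5 - 2 * s, a 3, a 4] := rfl
  simp [h, tangentLine, dotProduct, Matrix.mulVec, Fin.sum_univ_three, quartic]
  ring

theorem tangentialMatrix_tangentLine (a : Fin 6 → ℂ) (s : ℂ) (x₁ x₂ : OnePoint ℂ) :
    (tangentialMatrix a (s : OnePoint ℂ)).mulVec (tangentLine x₁) ⬝ᵥ tangentLine x₂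
      = -(2 * coeffL a x₁ x₂ * s + coeffK a x₁ x₂) := by
  have h : tangentialMatrix a (s : OnePoint ℂ) =
      !![a 0, a 1, a 5 - 2 * s; a 1, a 2 + s, a 3; a 5 - 2 * s, a 3, a 4] := rfl
  rw [coeffL_eq, coeffK_eq]
  simp [h, tangentLine, darbouxPoint, dotProduct, Matrix.mulVec, Fin.sum_univ_three]
  ring

theorem tangentialMatrix_tangentAt (a : Fin 6 → ℂ) (s : ℂ) (v z : Fin 3 → ℂ) :
    (tangentialMatrix a (s : OnePoint ℂ)).mulVec v ⬝ᵥ tangentAt a (s : OnePoint ℂ) z =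
      (tangentialMatrix a (s : OnePoint ℂ)).det * (v ⬝ᵥ z) := by
  rw [dotProduct_comm, Matrix.dotProduct_mulVec, ← Matrix.mulVec_transpose,
    (tangentialMatrix_isSymm a s).eq, tangentAt, Matrix.mulVec_mulVec, Matrix.mul_adjugate,
    Matrix.smul_mulVec, Matrix.one_mulVec, smul_dotProduct, smul_eq_mul, dotProduct_comm]

theorem darbouxPoint_ne_zero (x₁ x₂ : OnePoint ℂ) : darbouxPoint x₁ x₂ ≠ 0 := by
  intro h
  have h0 := congrFun h 0
  have h1 := congrFun h 1
  have h2 := congrFun h 2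
  induction x₁ using OnePoint.rec <;> induction x₂ using OnePoint.rec <;>
    simp [darbouxPoint] at h0 h1 h2

section

variable {a : Fin 6 → ℂ} {s : ℂ} {x₁ x₂ : OnePoint ℂ}

theorem tangentAt_dotProduct (h : OnConic a (s : OnePoint ℂ) (darbouxPoint x₁ x₂)) :
    tangentAt a (s : OnePoint ℂ) (darbouxPoint x₁ x₂) ⬝ᵥ darbouxPoint x₁ x₂ = 0 := by
  rw [(tangentAt_spec a _ _).1, show pointEq a _ _ = 0 from h, neg_zero]

/-- The values of the tangent at the vertex `x₁ ∩ x₂` at the other two vertices of a triangle. -/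
theorem vertex_relations (h : OnConic a (s : OnePoint ℂ) (darbouxPoint x₁ x₂)) (x₃ : OnePoint ℂ) :
    homDet x₂ x₃ * (tangentAt a (s : OnePoint ℂ) (darbouxPoint x₁ x₂) ⬝ᵥ darbouxPoint x₂ x₃)
        * quartic a x₁
      + homDet x₁ x₃ * (tangentAt a (s : OnePoint ℂ) (darbouxPoint x₁ x₂) ⬝ᵥ darbouxPoint x₁ x₃)
        * (2 * coeffL a x₁ x₂ * s + coeffK a x₁ x₂) = 0 ∧
    homDet x₂ x₃ * (tangentAt a (s : OnePoint ℂ) (darbouxPoint x₁ x₂) ⬝ᵥ darbouxPoint x₂ x₃)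
        * (2 * coeffL a x₁ x₂ * s + coeffK a x₁ x₂)
      + homDet x₁ x₃ * (tangentAt a (s : OnePoint ℂ) (darbouxPoint x₁ x₂) ⬝ᵥ darbouxPoint x₁ x₃)
        * quartic a x₂ = 0 := by
  have h0 := tangentAt_dotProduct h
  have e₁ := triangle_expansion x₁ x₂ x₃ (tangentAt a (s : OnePoint ℂ) (darbouxPoint x₁ x₂))
    ((tangentialMatrix a (s : OnePoint ℂ)).mulVec (tangentLine x₁))
  have e₂ := triangle_expansion x₁ x₂ x₃ (tangentAt a (s : OnePoint ℂ) (darbouxPoint x₁ x₂))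
    ((tangentialMatrix a (s : OnePoint ℂ)).mulVec (tangentLine x₂))
  have c : (tangentialMatrix a (s : OnePoint ℂ)).mulVec (tangentLine x₂) ⬝ᵥ tangentLine x₁
      = -(2 * coeffL a x₁ x₂ * s + coeffK a x₁ x₂) := by
    rw [tangentialMatrix_tangentLine, coeffL, coeffK_eq, darbouxPoint_comm x₂, coeffL, ← coeffK_eq]
  rw [tangentialMatrix_tangentAt, (darbouxPoint_mem x₁ x₂).1, tangentialMatrix_tangentLine_self,
    tangentialMatrix_tangentLine a s x₁ x₂, h0] at e₁
  rw [tangentialMatrix_tangentAt, (darbouxPoint_mem x₁ x₂).2, tangentialMatrix_tangentLine_self,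
    c, h0] at e₂
  exact ⟨by linear_combination -e₁, by linear_combination e₂⟩

theorem vertex_ne_zero (h : OnConic a (s : OnePoint ℂ) (darbouxPoint x₁ x₂))
    (hs : Nondegenerate a (s : OnePoint ℂ)) {x₃ : OnePoint ℂ}
    (h₁₂ : x₁ ≠ x₂) (h₁₃ : x₁ ≠ x₃) (h₂₃ : x₂ ≠ x₃) :
    ¬(tangentAt a (s : OnePoint ℂ) (darbouxPoint x₁ x₂) ⬝ᵥ darbouxPoint x₂ x₃ = 0 ∧
      tangentAt a (s : OnePoint ℂ) (darbouxPoint x₁ x₂) ⬝ᵥ darbouxPoint x₁ x₃ = 0) := by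
  rintro ⟨h₁, h₂⟩
  refine darbouxPoint_ne_zero x₁ x₂ (dotProduct_eq_zero _ fun v => ?_)
  have e := triangle_expansion x₁ x₂ x₃ (tangentAt a (s : OnePoint ℂ) (darbouxPoint x₁ x₂))
    ((tangentialMatrix a (s : OnePoint ℂ)).mulVec v)
  rw [h₁, h₂, tangentAt_dotProduct h, tangentialMatrix_tangentAt] at e
  have hd : (tangentialMatrix a (s : OnePoint ℂ)).det ≠ 0 := hs
  simpa [homDet_ne_zero h₁₂, homDet_ne_zero h₁₃, homDet_ne_zero h₂₃, hd,
    dotProduct_comm v] using e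

theorem exists_coe_of_onConic {s x₁ x₂ : OnePoint ℂ} (h : OnConic a s (darbouxPoint x₁ x₂))
    (hne : x₁ ≠ x₂) : ∃ s' : ℂ, s = s' := by
  induction s using OnePoint.rec with
  | infty =>
    have hL : coeffL a x₁ x₂ = 0 := h
    rw [coeffL_eq, pow_eq_zero_iff two_ne_zero, hom_det_eq_zero_iff] at hL
    exact absurd hL hne
  | coe s => exact ⟨s, rfl⟩

end

section

variable {a : Fin 6 → ℂ} {s₁ s₂ s₃ : OnePoint ℂ} {M N K : Gamma1 a}

/-- Along a chain of values the tangents at the vertices are concurrent if and only if the last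
branch condition is violated. -/
theorem vertexTangents_relation (h₁₂ : M.x ≠ N.x) (h₂₃ : N.x ≠ K.x) (h₁₃ : M.x ≠ K.x)
    (c₁ : OnConic a s₁ (darbouxPoint M.x N.x)) (c₂ : OnConic a s₂ (darbouxPoint N.x K.x))
    (c₃ : OnConic a s₃ (darbouxPoint M.x K.x))
    (b₁ : BranchCondition a M N s₁) (b₂ : BranchCondition a N K s₂) :
    (VertexTangentsNotConcurrent a s₁ s₂ s₃ M.x N.x K.x → BranchCondition a M K s₃) ∧
    (M.y ≠ 0 → N.y ≠ 0 → K.y ≠ 0 → Nondegenerate a s₁ → Nondegenerate a s₂ → Nondegenerate a s₃ →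
      BranchCondition a M K s₃ → VertexTangentsNotConcurrent a s₁ s₂ s₃ M.x N.x K.x) := by
  obtain ⟨s₁, rfl⟩ := exists_coe_of_onConic c₁ h₁₂
  obtain ⟨s₂, rfl⟩ := exists_coe_of_onConic c₂ h₂₃
  obtain ⟨s₃, rfl⟩ := exists_coe_of_onConic c₃ h₁₃
  have hd₁₂ := homDet_ne_zero h₁₂
  have hd₁₃ := homDet_ne_zero h₁₃
  have hd₂₃ := homDet_ne_zero h₂₃
  have v₁ := vertex_relations c₁ K.x
  have v₂ := vertex_relations c₂ M.x
  have v₃ := vertex_relations c₃ N.x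
  have n₁ := vertex_ne_zero (x₃ := K.x) c₁ (h₁₂ := h₁₂) (h₁₃ := h₁₃) (h₂₃ := h₂₃)
  have n₂ := vertex_ne_zero (x₃ := M.x) c₂ (h₁₂ := h₂₃) (h₁₃ := h₁₂.symm) (h₂₃ := h₁₃.symm)
  have n₃ := vertex_ne_zero (x₃ := N.x) c₃ (h₁₂ := h₁₃) (h₁₃ := h₁₂) (h₂₃ := h₂₃.symm)
  have hsq := pencilDeriv_sq c₃
  rw [show pencilDeriv a M.x K.x (s₃ : OnePoint ℂ) =
    2 * coeffL a M.x K.x * s₃ + coeffK a M.x K.x from rfl] at hsq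
  rw [VertexTangentsNotConcurrent, concurrent_iff_vertices h₁₂ h₁₃ h₂₃ (tangentAt_dotProduct c₁)
    (tangentAt_dotProduct c₂) (tangentAt_dotProduct c₃)]
  rw [show BranchCondition a M K (s₃ : OnePoint ℂ) ↔
    2 * coeffL a M.x K.x * s₃ + coeffK a M.x K.x = M.y * K.y from Iff.rfl]
  rw [show 2 * coeffL a M.x N.x * s₁ + coeffK a M.x N.x = M.y * N.y from b₁] at v₁
  rw [show 2 * coeffL a N.x K.x * s₂ + coeffK a N.x K.x = N.y * K.y from b₂] at v₂
  simp only [darbouxPoint_comm K.x, darbouxPoint_comm N.x M.x] at v₂ v₃ n₂ n₃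
  rw [homDet_swap M.x K.x, homDet_swap M.x N.x] at v₂
  rw [homDet_swap N.x K.x] at v₃
  simp only [← M.eq, ← N.eq, ← K.eq] at v₁ v₂ v₃ hsq
  generalize 2 * coeffL a M.x K.x * s₃ + coeffK a M.x K.x = m at *
  generalize tangentAt a (s₁ : OnePoint ℂ) (darbouxPoint M.x N.x) = t₁ at *
  generalize tangentAt a (s₂ : OnePoint ℂ) (darbouxPoint N.x K.x) = t₂ at *
  generalize tangentAt a (s₃ : OnePoint ℂ) (darbouxPoint M.x K.x) = t₃ at *
  generalize t₁ ⬝ᵥ darbouxPoint N.x K.x = α₁ at *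
  generalize t₁ ⬝ᵥ darbouxPoint M.x K.x = β₁ at *
  generalize t₂ ⬝ᵥ darbouxPoint M.x K.x = α₂ at *
  generalize t₂ ⬝ᵥ darbouxPoint M.x N.x = β₂ at *
  generalize t₃ ⬝ᵥ darbouxPoint M.x N.x = α₃ at *
  generalize t₃ ⬝ᵥ darbouxPoint N.x K.x = β₃ at *
  generalize homDet M.x N.x = d₁₂ at *
  generalize homDet M.x K.x = d₁₃ at *
  generalize homDet N.x K.x = d₂₃ at *
  obtain ⟨v₁, v₁'⟩ := v₁
  obtain ⟨v₂, v₂'⟩ := v₂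
  obtain ⟨v₃, v₃'⟩ := v₃
  generalize M.y = y₁ at *
  generalize N.y = y₂ at *
  generalize K.y = y₃ at *
  have r₁ : y₁ ≠ 0 → d₂₃ * α₁ * y₁ = -(d₁₃ * β₁ * y₂) := fun h => by
    refine mul_left_cancel₀ h ?_
    linear_combination v₁
  have r₂ : y₃ ≠ 0 → d₁₃ * α₂ * y₂ = -(d₁₂ * β₂ * y₃) := fun h => by
    refine mul_left_cancel₀ h ?_
    linear_combination -v₂'
  constructor
  · intro hc
    have hm : (m - y₁ * y₃) * (m + y₁ * y₃) = 0 := by linear_combination hsq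
    by_cases h1 : y₁ = 0
    · rw [h1] at hm ⊢
      have : m ^ 2 = 0 := by linear_combination hm
      rw [pow_eq_zero_iff two_ne_zero] at this
      rw [this, zero_mul]
    by_cases h3 : y₃ = 0
    · rw [h3] at hm ⊢
      have : m ^ 2 = 0 := by linear_combination hm
      rw [pow_eq_zero_iff two_ne_zero] at this
      rw [this, mul_zero]
    rcases mul_eq_zero.1 hm with h | h
    · linear_combination h
    exfalso
    have hm : m = -(y₁ * y₃) := by linear_combination h
    apply hc
    have r₃ : d₁₂ * α₃ * y₃ = -(d₂₃ * β₃ * y₁) := by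
      refine mul_left_cancel₀ h1 ?_
      rw [hm] at v₃
      linear_combination -v₃
    by_cases h2 : y₂ = 0
    · have e₁ : α₁ = 0 := by
        have := r₁ h1
        rw [h2] at this
        simpa [hd₂₃, h1] using this
      have e₂ : β₂ = 0 := by
        have := r₂ h3
        rw [h2] at this
        simpa [hd₁₂, h3] using this
      rw [e₁, e₂]
      ring
    · have hne : d₁₂ * d₁₃ * d₂₃ * (y₁ * y₂ * y₃) ≠ 0 := by
        simp [hd₁₂, hd₁₃, hd₂₃, h1, h2, h3]
      refine mul_left_cancel₀ hne ?_
      linear_combination d₁₃ * α₂ * y₂ * (d₁₂ * α₃ * y₃) * r₁ h1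
        - d₁₃ * β₁ * y₂ * (d₁₂ * α₃ * y₃) * r₂ h3 + d₁₃ * β₁ * y₂ * (d₁₂ * β₂ * y₃) * r₃
  · intro h1 h2 h3 g₁ g₂ g₃ hm hc
    have r₃ : d₁₂ * α₃ * y₃ = d₂₃ * β₃ * y₁ := by
      refine mul_left_cancel₀ h1 ?_
      rw [hm] at v₃
      linear_combination v₃
    have hne : d₁₂ * d₁₃ * d₂₃ * (y₁ * y₂ * y₃) ≠ 0 := by
      simp [hd₁₂, hd₁₃, hd₂₃, h1, h2, h3]
    have key : α₁ * α₂ * α₃ = β₁ * β₂ * β₃ := by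
      refine mul_left_cancel₀ hne ?_
      linear_combination d₁₃ * α₂ * y₂ * (d₁₂ * α₃ * y₃) * r₁ h1
        - d₁₃ * β₁ * y₂ * (d₁₂ * α₃ * y₃) * r₂ h3 + d₁₃ * β₁ * y₂ * (d₁₂ * β₂ * y₃) * r₃
    have h0 : α₁ * α₂ * α₃ = 0 := by linear_combination (hc + key) / 2
    rcases mul_eq_zero.1 h0 with h0 | h0
    · rcases mul_eq_zero.1 h0 with h0 | h0
      · refine n₁ g₁ ⟨h0, ?_⟩
        have := r₁ h1
        rw [h0] at this
        simpa [hd₁₃, h2] using this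
      · refine n₂ g₂ ⟨h0, ?_⟩
        have := r₂ h3
        rw [h0] at this
        simpa [hd₁₂, h3] using this
    · refine n₃ g₃ ⟨?_, h0⟩
      rw [h0] at r₃
      simpa [hd₂₃, h1] using r₃

end

/-! ## The main theorem -/

theorem not_isCommonTangent_iff {a : Fin 6 → ℂ} (M : Gamma1 a) :
    ¬ IsCommonTangent a M.x ↔ M.y ≠ 0 := by
  rw [isCommonTangent_iff, ← M.eq, Ne, pow_eq_zero_iff two_ne_zero]

namespace BranchPoint

variable {a : Fin 6 → ℂ} (B : BranchPoint a)

theorem greatPoncelet (B : BranchPoint a) : GreatPonceletForTriangles a := by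
  intro s₁ s₂ s₃ g₁ g₂ g₃ a₁ a₂ a₃ T b₁ b₂ hb
  obtain ⟨P, rfl⟩ := B.exists_pencilParam_eq s₁
  obtain ⟨Q, rfl⟩ := B.exists_pencilParam_eq s₂
  obtain ⟨R, rfl⟩ := B.exists_pencilParam_eq s₃
  obtain ⟨M, rfl⟩ := exists_over (a := a) a₁
  obtain ⟨N, rfl, hN⟩ := exists_isValue P M T.on₁
  obtain ⟨K, rfl, hK⟩ := exists_isValue Q N T.on₂
  have hR : IsValue a R M K := ⟨T.on₃, (vertexTangents_relation T.ne₁₂ T.ne₂₃ T.ne₁₃ T.on₁ T.on₂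
    T.on₃ hN.2 hK.2).1 T.not_concurrent⟩
  have hmem := B.mem_groupOp_of_chain hN hK hR
  obtain ⟨M', rfl⟩ := exists_over (a := a) b₁
  obtain ⟨N', rfl, hN'⟩ := exists_isValue P M' hb
  obtain ⟨K', hK', hR'⟩ := B.exists_isValue_chain hmem hN'
  refine ⟨K'.x, hK'.1, hR'.1, fun h₁₂ h₂₃ h₁₃ t₁ t₂ t₃ => ⟨h₁₂, h₂₃, h₁₃, hb, hK'.1, hR'.1, ?_⟩⟩
  rw [not_isCommonTangent_iff] at t₁ t₂ t₃
  exact (vertexTangents_relation h₁₂ h₂₃ h₁₃ hb hK'.1 hR'.1 hN'.2 hK'.2).2 t₁ t₂ t₃ g₁ g₂ g₃ hR'.2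

theorem bind_pencilAction_of_mem (B : BranchPoint a) {P Q R : CosetGroup a}
    (h : R ∈ groupOp a Q P) : ∃ R' : CosetGroup a, ∀ M : Gamma1 a,
      ((pencilAction a P M : Multiset (Gamma1 a)).bind
        fun N => (pencilAction a Q N : Multiset (Gamma1 a))) =
      (pencilAction a R M : Multiset (Gamma1 a)) + (pencilAction a R' M : Multiset (Gamma1 a)) := by
  have hR : ∃ R', (groupOp a Q P : Multiset (CosetGroup a)) = {R, R'} := by
    rw [← Sym.mem_coe] at h
    obtain ⟨t, ht⟩ := Multiset.exists_cons_of_mem h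
    have hcard : t.card = 1 := by
      have := congrArg Multiset.card ht
      rw [Sym.card_coe, Multiset.card_cons] at this
      omega
    obtain ⟨R', rfl⟩ := Multiset.card_eq_one.1 hcard
    exact ⟨R', ht⟩
  obtain ⟨R', hR'⟩ := hR
  refine ⟨R', fun M => ?_⟩
  have := B.actionAssociative Q P M
  rw [hR'] at this
  simpa [Multiset.insert_eq_cons] using this

theorem mem_of_bind_pencilAction (B : BranchPoint a) {P Q R R' : CosetGroup a} (M : Gamma1 a)
    (h : ((pencilAction a P M : Multiset (Gamma1 a)).bind
        fun N => (pencilAction a Q N : Multiset (Gamma1 a))) =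
      (pencilAction a R M : Multiset (Gamma1 a)) + (pencilAction a R' M : Multiset (Gamma1 a))) :
    R ∈ groupOp a Q P := by
  have mem_iff : ∀ (P : CosetGroup a) (M K : Gamma1 a),
      K ∈ (pencilAction a P M : Multiset (Gamma1 a)) ↔ IsValue a P M K := by
    intro P M K
    induction P using coset_induction with | h p
    rw [B.isValue_iff, ← Multiset.mem_map_of_injective B.toGamma2_bijective.1, B.map_pencilAction]
    simp
  obtain ⟨K, hK⟩ : ∃ K, IsValue a R M K := by
    obtain ⟨g, rfl⟩ : ∃ g, CosetSpace.mk g = R := Quotient.exists_rep R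
    obtain ⟨K, hK⟩ := B.toGamma2_bijective.2 (B.toGamma2 M + g)
    exact ⟨K, (B.isValue_iff _ _ _).2 (Or.inl hK)⟩
  have hmem : K ∈ (pencilAction a R M : Multiset (Gamma1 a)) +
      (pencilAction a R' M : Multiset (Gamma1 a)) :=
    Multiset.mem_add.2 (Or.inl ((mem_iff _ _ _).2 hK))
  rw [← h, Multiset.mem_bind] at hmem
  obtain ⟨N, hN, hNK⟩ := hmem
  exact B.mem_groupOp_of_chain ((mem_iff _ _ _).1 hN) ((mem_iff _ _ _).1 hNK) hK

theorem mem_of_isPoristic (B : BranchPoint a) {P Q R : CosetGroup a}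
    (h : IsPoristic a (pencilParam a P) (pencilParam a Q) (pencilParam a R)) :
    R ∈ groupOp a Q P := by
  obtain ⟨p, rfl⟩ : ∃ g, CosetSpace.mk g = P := Quotient.exists_rep P
  obtain ⟨q, rfl⟩ : ∃ g, CosetSpace.mk g = Q := Quotient.exists_rep Q
  obtain ⟨r, rfl⟩ : ∃ g, CosetSpace.mk g = R := Quotient.exists_rep R
  have := B.infinite_gamma2
  let S : Set (Gamma2 a) := {-(p + q + r), -(p + q - r), -(p - q + r), -(p - q - r)}
  have hS : (⋃ c ∈ S, {g : Gamma2 a | g + g = c}).Finite :=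
    Set.Finite.biUnion (by simp [S]) fun c _ =>
      finite_add_self_eq (gamma2Curve_a₁ a) (gamma2Curve_a₃ a) c
  obtain ⟨m, hm⟩ := hS.exists_notMem
  have hm : m + m ∉ S := by simpa using hm
  obtain ⟨M, rfl⟩ := B.toGamma2_bijective.2 m
  obtain ⟨N, hN⟩ := B.toGamma2_bijective.2 (B.toGamma2 M + p)
  have hP : IsValue a (CosetSpace.mk p) M N := (B.isValue_iff _ _ _).2 (Or.inl hN)
  obtain ⟨x, hQ, hR⟩ := h M.x N.x hP.1
  obtain ⟨K, rfl, hK⟩ := exists_isValue _ N hQ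
  obtain ⟨K', hx, hK'⟩ := exists_isValue _ M hR
  rcases B.toGamma2_eq_or_neg hx with e | e
  · rw [B.toGamma2_bijective.1 e] at hK'
    exact B.mem_groupOp_of_chain hP hK hK'
  · rw [B.isValue_iff] at hK hK'
    refine absurd ?_ hm
    rw [hN] at hK
    have e' : B.toGamma2 M + B.toGamma2 M =
        (B.toGamma2 M - B.toGamma2 K') - (B.toGamma2 K - B.toGamma2 M) := by
      rw [e]
      abel
    rw [e']
    rcases hK with hK | hK <;> rcases hK' with hK' | hK' <;> rw [hK, hK']
    · left; abel
    · right; left; abel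
    · right; right; left; abel
    · right; right; right
      rw [Set.mem_singleton_iff]
      abel

end BranchPoint

end ConicPencil

open MultiValued ConicPencil in
theorem mainTheorem2 (a : Fin 6 → ℂ) (ha : GeneralPosition a) :
    (∀ (P : CosetGroup a) (M : Gamma1 a), ∃ N₁ N₂ : Gamma1 a,
        pencilAction a P M = pair N₁ N₂ ∧ ∀ N : Gamma1 a, IsValue a P M N ↔ N = N₁ ∨ N = N₂) ∧
    (Associative (groupOp a) ∧ ActionAssociative (groupOp a) (pencilAction a) ↔
      GreatPonceletForTriangles a) ∧
    (∀ P Q R : CosetGroup a,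
      [R ∈ groupOp a Q P,
        ∃ R' : CosetGroup a, ∀ M : Gamma1 a,
          ((pencilAction a P M : Multiset (Gamma1 a)).bind
              fun N => (pencilAction a Q N : Multiset (Gamma1 a))) =
            (pencilAction a R M : Multiset (Gamma1 a)) + (pencilAction a R' M : Multiset (Gamma1 a)),
        IsPoristic a (pencilParam a P) (pencilParam a Q) (pencilParam a R)].TFAE) := by
  obtain ⟨B⟩ := ha.nonempty_branchPoint
  refine ⟨fun P M => ?_, ⟨fun _ => B.greatPoncelet, fun _ =>
    ⟨associative_cosetMul _, B.actionAssociative⟩⟩, fun P Q R => ?_⟩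
  · obtain ⟨g, rfl⟩ : ∃ g, CosetSpace.mk g = P := Quotient.exists_rep P
    obtain ⟨N₁, N₂, h₁, h₂, h⟩ := B.exists_values g M
    refine ⟨N₁, N₂, h, fun N => ?_⟩
    rw [B.isValue_iff, ← h₁, ← h₂, B.toGamma2_bijective.1.eq_iff, B.toGamma2_bijective.1.eq_iff]
  · tfae_have 1 → 2 := B.bind_pencilAction_of_mem
    tfae_have 2 → 1 := by
      rintro ⟨R', h⟩
      obtain ⟨M, -⟩ := exists_over (a := a) OnePoint.infty
      exact B.mem_of_bind_pencilAction M (h M)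
    tfae_have 1 → 3 := B.isPoristic_of_mem
    tfae_have 3 → 1 := B.mem_of_isPoristic
    tfae_finish
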